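/- **Setting.** Let $\mathcal S,\mathcal A$ be finite, $H,n\ge 1$, and let $\phi:\mathcal S\times\mathcal A\to\mathbb R^n$ satisfy $\phi_i\ge 0$ and $\sum_i\phi_i=1$. An $n$-rectangular linear DRMDP $M$ with feature map $\phi$ and horizon $H$ consists of $\theta_h\in\mathbb R^n$ with $\|\theta_h\|_2\le\sqrt n$ and $r_h(s,a)=\langle\phi(s,a),\theta_h\rangle\in[0,1]$, and of probability distributions $\mu^0_{h,i}$ on $\mathcal S$, for $h\in[H]$, $i\in[n]$. Its nominal kernels are $P^0_h(\cdot|s,a)=\sum_i\phi_i(s,a)\mu^0_{h,i}$. For uncertainty levels $\rho=(\rho_h)_h$, the uncertainty set $\mathcal U^\rho(P^0)$ is the product over all $(h,s,a)$ of $\{\sum_i\phi_i(s,a)\mu_i:\ D_{TV}(\mu_i\|\mu^0_{h,i})\le\rho_h\ \forall i\}$, where $D_{TV}(p\|q)=\frac12\sum_s|p(s)-q(s)|$; a single level $\rho$ means $\rho_h=\rho$ for all $h$. Put $V^{\pi,P}_h(s)=\mathbb E^{\pi,P}[\sum_{t=h}^H r_t(s_t,a_t)|s_h=s]$, $V^{\pi,\rho}_h=\inf_{P\in\mathcal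 U^\rho(P^0)}V^{\pi,P}_h$, $V^{\star,\rho}_h=\sup_\pi V^{\pi,\rho}_h$ (over Markov, possibly randomized policies, $V_{H+1}=0$) and $\mathrm{SubOpt}(M,\pi,s,\rho)=V_1^{\star,\rho}(s)-V_1^{\pi,\rho}(s)$. A policy $\pi^\star$ is optimal if $V_h^{\pi^\star,\rho}(s)=V_h^{\star,\rho}(s)$ for all $h,s$. The offline dataset $\mathcal D$ consists of $K$ i.i.d. trajectories $(s_h^\tau,a_h^\tau,r_h^\tau)_{h\in[H]}$ from the nominal environment, with a given initial distribution, a given behavior policy $\pi^b$, and independent observed rewards $r_h^\tau\sim\mathcal N(r_h(s_h^\tau,a_h^\tau),1)$. For $\lambda>0$ let $$\Sigma_h^\star=\sum_{\tau=1}^K\frac{\phi(s_h^\tau,a_h^\tau)\phi(s_h^\tau,a_h^\tau)^\top}{[\mathbb V_hV^{\star,\rho}_{h+1}](s_h^\tau,a_h^\tau)}+\lambda I,\qquad [\mathbb V_hV](s,a)=\max\{1,\mathrm{Var}_{s'\sim P_h^0(\cdot|s,a)}V(s')\},$$ $$\Phi_{M,\pi^\star,\lambda}(\mathcal D,s)=\sup_{P\in\mathcal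 U^\rho(P^0)}\sum_{h=1}^H\mathbb E^{\pi^\star,P}\Big[\sum_{i=1}^n\|\phi_i(s_h,a_h)\mathbf 1_i\|_{\Sigma_h^{\star-1}}\,\Big|\,s_1=s\Big],$$ where $\mathbf 1_i$ is the $i$-th unit vector and $\|x\|_B=\sqrt{x^\top Bx}$. For a class $\mathcal M$ of such DRMDPs, all with the same $\phi$, initial distribution and $\pi^b$, let $$R_K(\mathcal M,s)=\inf_{\hat\pi}\sup_{M\in\mathcal M}\mathbb E_{\mathcal D\sim M}\big[\mathrm{SubOpt}(M,\hat\pi(\mathcal D),s,\rho)\big],$$ where $\hat\pi$ ranges over all measurable maps from datasets to policies. Say that $\mathcal M$ *satisfies the lower bound* on $T\subseteq\mathcal S$ with constants $c,\delta$ if: $\mathcal M\ne\emptyset$; for each $M\in\mathcal M$ and $h\in[H]$ the matrix $\mathbb E^{\pi^b,P^0}[\phi(s_h,a_h)\phi(s_h,a_h)^\top]$ is positive definite; each $M\in\mathcal M$ has an optimal policy; and for every $\lambda>0$ and every $M_0\in\mathcal M$ generating $\mathcal D$, with probability at least $1-\delta$, $$R_K(\mathcal M,s)\ \ge\ c\cdot\Phi_{M,\pi^\star,\lambda}(\mathcal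 D,s)\quad\text{for all } s\in T,\ M\in\mathcal M\text{ and all optimal policies }\pi^\star\text{ of }M.$$ **Theorem.** There are universal constants $c,C>0$ such that for all $\rho\in(0,3/4]$, $\delta\in(0,1)$, integers $d,H\ge1$ and $K>C\,d^6\log(2dH/\delta)$ the following hold. 1. There are a feature map $\phi:\mathcal S\times\mathcal A\to\mathbb R^{d+2}$ with two states and $\mathcal A=\{0,1\}^d$, an initial distribution, a behavior policy, and a class $\mathcal M$ of $(d+2)$-rectangular linear DRMDPs with feature map $\phi$ and horizon $H$ that satisfies the lower bound on $T=\mathcal S$ with constants $c,\delta$, for the uncertainty level $\rho$ at every step. 2. Let $\mathcal S=\{x_1,x_2\}$, $\mathcal A=\{0,1\}^d$, $\phi(x_1,a)=(\frac{a_1}d,\dots,\frac{a_d}d,1-\sum_i\frac{a_i}d,0)$, $\phi(x_2,a)=(0,\dots,0,1)$, $\mu^0_h=(\delta_{x_1},\dots,\delta_{x_1},\delta_{x_2})$, and $\theta_h=\eta\,(\frac{\xi_{h1}+1}2,\dots,\frac{\xi_{hd}+1}2,\frac12,0)$ with $\eta=d^{3/2}/\sqrt{2K}$. Let the initial distribution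 give mass $\frac{d+1}{d+2}$ to $x_1$ and $\frac1{d+2}$ to $x_2$, and let $\pi^b_h$ be uniform on $\{e_1,\dots,e_d,0\}$. For every choice of signs $\xi_{hi}\in\{-1,1\}$ this is a $(d+2)$-rectangular linear DRMDP, and the class of all of them satisfies the lower bound on $T=\{x_1\}$ with constants $c,\delta$, for the uncertainty level $\rho$ at the first step and $0$ at the later steps. -/

import Mathlib

open MeasureTheory ProbabilityTheory
open scoped ENNReal BigOperators

noncomputable section

namespace DRMDP

/-- `Δ(S)`: the probability distributions on a finite set `S`. -/
abbrev Distr (S : Type*) [Fintype S] : Type _ := {p : S → ℝ // p ∈ stdSimplex ℝ S}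

/-- The total variation distance `(1/2) ∑ₛ |p(s) - q(s)|`. -/
def tvDist {S : Type*} [Fintype S] (p q : Distr S) : ℝ := (1 / 2) * ∑ s, |p.1 s - q.1 s|

/-- The mixture `∑ᵢ wᵢ μᵢ`. -/
def mix {ι S : Type*} [Fintype ι] [Fintype S] (w : Distr ι) (μ : ι → Distr S) : Distr S :=
  ⟨fun s => ∑ i, w.1 i * (μ i).1 s, by
    refine ⟨fun s => Finset.sum_nonneg fun i _ => mul_nonneg (w.2.1 i) ((μ i).2.1 s), ?_⟩
    rw [Finset.sum_comm]
    simp only [← Finset.mul_sum, (μ _).2.2, mul_one, w.2.2]⟩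

/-- A (Markov, possibly randomized) policy: `(π h s) a` is the probability of the action `a` in the
state `s` at step `h`. Steps are numbered `0, 1, …, H - 1`; in all objects indexed by `h : ℕ` the
entries with `h ≥ H` play no role. -/
abbrev Policy (S A : Type*) [Fintype A] : Type _ := ℕ → S → Distr A

/-- A sequence of transition kernels: `(P h s a) s'` is the probability of moving from `s` to `s'`
when the action `a` is taken at step `h`. -/
abbrev Transition (S A : Type*) [Fintype S] : Type _ := ℕ → S → A → Distr S

section Chain

variable {S A : Type*} [Fintype S] [Fintype A]

/-- The law of the state `s_{h+k}` given that `s_h` has the distribution `ν`, for the Markov chain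
with `a_t ∼ π_t(· | s_t)` and `s_{t+1} ∼ P_t(· | s_t, a_t)`. -/
def stateLaw (π : Policy S A) (P : Transition S A) (h : ℕ) (ν : S → ℝ) : ℕ → S → ℝ
  | 0 => ν
  | k + 1 => fun s' =>
      ∑ s, ∑ a, stateLaw π P h ν k s * (π (h + k) s).1 a * (P (h + k) s a).1 s'

/-- `𝔼^{π,P}[f(s_{h+k}, a_{h+k})]` where `s_h ∼ ν`. -/
def expect (π : Policy S A) (P : Transition S A) (h : ℕ) (ν : S → ℝ) (k : ℕ) (f : S → A → ℝ) : ℝ :=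
  ∑ s, ∑ a, stateLaw π P h ν k s * (π (h + k) s).1 a * f s a

/-- The value function `V_h^{π,P}(s) = 𝔼^{π,P}[∑_{t=h}^{H-1} r_t(s_t, a_t) | s_h = s]`. -/
def value [DecidableEq S] (H : ℕ) (r : ℕ → S → A → ℝ) (π : Policy S A) (P : Transition S A)
    (h : ℕ) (s : S) : ℝ :=
  ∑ k ∈ Finset.range (H - h), expect π P h (Pi.single s 1) k (r (h + k))

/-- The probability of the state-action path `(s_0, a_0), …, (s_{H-1}, a_{H-1})` when `s_0 ∼ ν`,
`a_h ∼ π_h(· | s_h)` and `s_{h+1} ∼ P_h(· | s_h, a_h)`. -/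
def pathProb {H : ℕ} (ν : Distr S) (π : Policy S A) (P : Transition S A) (p : Fin H → S × A) : ℝ :=
  ∏ h : Fin H,
    (if h.1 = 0 then ν.1 (p h).1
      else (P (h.1 - 1) (p ⟨h.1 - 1, by omega⟩).1 (p ⟨h.1 - 1, by omega⟩).2).1 (p h).1)
    * (π h.1 (p h).1).1 (p h).2

end Chain

/-- An `n`-rectangular linear distributionally robust MDP of horizon `H` with the feature map `φ`,
whose values are nonnegative vectors with sum one. The data are the reward parameters `θ_h` and the
nominal factor distributions `μ⁰_{h,i}`. -/
structure LinearDRMDP {S A : Type*} [Fintype S] {n : ℕ} (φ : S → A → Distr (Fin n)) (H : ℕ) where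
  /-- the reward parameters -/
  θ : ℕ → Fin n → ℝ
  /-- the nominal factor distributions -/
  μ : ℕ → Fin n → Distr S
  θ_norm_le : ∀ h < H, √(∑ i, θ h i ^ 2) ≤ √n
  reward_mem : ∀ h < H, ∀ s a, ∑ i, (φ s a).1 i * θ h i ∈ Set.Icc (0 : ℝ) 1

namespace LinearDRMDP

variable {S A : Type*} [Fintype S] [DecidableEq S] [Fintype A] {n H : ℕ}
  {φ : S → A → Distr (Fin n)}

/-- The mean reward `r_h(s,a) = ⟨φ(s,a), θ_h⟩`. -/
def reward (M : LinearDRMDP φ H) (h : ℕ) (s : S) (a : A) : ℝ := ∑ i, (φ s a).1 i * M.θ h i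

/-- The nominal transition kernels `P⁰_h(· | s,a) = ⟨φ(s,a), μ⁰_h(·)⟩`. -/
def nominal (M : LinearDRMDP φ H) : Transition S A := fun h s a => mix (φ s a) (M.μ h)

/-- The `n`-rectangular total variation uncertainty set `𝓤^ρ(P⁰)`: the product over all `h` and all
`(s,a)` of the sets `{∑ᵢ φᵢ(s,a) νᵢ : TV(νᵢ, μ⁰_{h,i}) ≤ ρ_h for all i}`. The uncertainty level may
depend on the step; a constant sequence gives the usual set with a single level. -/
def uncertaintySet (M : LinearDRMDP φ H) (ρ : ℕ → ℝ) : Set (Transition S A) :=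
  {P | ∀ h s a, ∃ ν : Fin n → Distr S,
    (∀ i, tvDist (ν i) (M.μ h i) ≤ ρ h) ∧ P h s a = mix (φ s a) ν}

/-- The robust value function `V_h^{π,ρ}(s) = inf_{P ∈ 𝓤^ρ(P⁰)} V_h^{π,P}(s)`. -/
def robustValue (M : LinearDRMDP φ H) (ρ : ℕ → ℝ) (π : Policy S A) (h : ℕ) (s : S) : ℝ :=
  ⨅ P : M.uncertaintySet ρ, value H M.reward π P.1 h s

/-- The optimal robust value function `V_h^{⋆,ρ}(s) = sup_π V_h^{π,ρ}(s)`. -/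
def optValue (M : LinearDRMDP φ H) (ρ : ℕ → ℝ) (h : ℕ) (s : S) : ℝ :=
  ⨆ π : Policy S A, M.robustValue ρ π h s

/-- `π` is an optimal robust policy: it attains the optimal robust value at all steps and states. -/
def IsOptimal (M : LinearDRMDP φ H) (ρ : ℕ → ℝ) (π : Policy S A) : Prop :=
  ∀ h < H, ∀ s, M.robustValue ρ π h s = M.optValue ρ h s

/-- The suboptimality gap `V_1^{⋆,ρ}(s) - V_1^{π,ρ}(s)` (the first step has the number `0`). -/
def subOpt (M : LinearDRMDP φ H) (ρ : ℕ → ℝ) (π : Policy S A) (s : S) : ℝ :=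
  M.optValue ρ 0 s - M.robustValue ρ π 0 s

/-- The truncated variance `max {1, Var_{s' ∼ P⁰_h(· | s,a)} V_{h+1}^{⋆,ρ}(s')}`. -/
def truncVar (M : LinearDRMDP φ H) (ρ : ℕ → ℝ) (h : ℕ) (s : S) (a : A) : ℝ :=
  max 1 (∑ s', (M.nominal h s a).1 s' * M.optValue ρ (h + 1) s' ^ 2
    - (∑ s', (M.nominal h s a).1 s' * M.optValue ρ (h + 1) s') ^ 2)

/-- The second moment matrix `𝔼^{π,P⁰}[φ(s_h,a_h) φ(s_h,a_h)ᵀ]` of the features at step `h` under the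
nominal kernels, with initial distribution `ν`. -/
def featureCov (M : LinearDRMDP φ H) (ν : Distr S) (π : Policy S A) (h : ℕ) :
    Matrix (Fin n) (Fin n) ℝ :=
  Matrix.of fun i j => expect π M.nominal 0 ν.1 h fun s a => (φ s a).1 i * (φ s a).1 j

end LinearDRMDP

/-- A data set of `K` trajectories `(s_h, a_h, r_h)`, `h < H`. -/
abbrev Dataset (S A : Type*) (H K : ℕ) : Type _ := Fin K → Fin H → S × A × ℝ

/-- The Mahalanobis norm `‖x‖_B = √(xᵀ B x)`. -/
def matNorm {n : ℕ} (B : Matrix (Fin n) (Fin n) ℝ) (x : Fin n → ℝ) : ℝ :=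
  √(x ⬝ᵥ B.mulVec x)

namespace LinearDRMDP

section

variable {S A : Type*} [Fintype S] [DecidableEq S] [Fintype A] {n H K : ℕ}
  {φ : S → A → Distr (Fin n)}

/-- The variance-weighted covariance matrix, with regularization parameter `lam`,
`Σ_h^⋆ = ∑_τ φ(s_h^τ,a_h^τ) φ(s_h^τ,a_h^τ)ᵀ / [𝕍_h V_{h+1}^{⋆,ρ}](s_h^τ,a_h^τ) + lam I`. -/
def weightedCov (M : LinearDRMDP φ H) (ρ : ℕ → ℝ) (lam : ℝ) (D : Dataset S A H K) (h : Fin H) :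
    Matrix (Fin n) (Fin n) ℝ :=
  ∑ τ, (M.truncVar ρ h (D τ h).1 (D τ h).2.1)⁻¹ •
      Matrix.vecMulVec (φ (D τ h).1 (D τ h).2.1).1 (φ (D τ h).1 (D τ h).2.1).1
    + lam • (1 : Matrix (Fin n) (Fin n) ℝ)

/-- The instance-dependent uncertainty function
`sup_{P ∈ 𝓤^ρ(P⁰)} ∑_h 𝔼^{π,P}[∑ᵢ ‖φᵢ(s_h,a_h) 𝟏ᵢ‖_{(Σ_h^⋆)⁻¹} | s_1 = s]`. -/
def uncertainty (M : LinearDRMDP φ H) (ρ : ℕ → ℝ) (lam : ℝ) (D : Dataset S A H K) (π : Policy S A) (s : S) :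
    ℝ :=
  ⨆ P : M.uncertaintySet ρ, ∑ h : Fin H,
    expect π P.1 0 (Pi.single s 1) h fun s' a =>
      ∑ i, matNorm (M.weightedCov ρ lam D h)⁻¹ (Pi.single i ((φ s' a).1 i))

end

section

variable {S A : Type*} [Fintype S] [DecidableEq S] [Fintype A] [MeasurableSpace S]
  [MeasurableSpace A] {n H : ℕ} {φ : S → A → Distr (Fin n)}

/-- The law of one trajectory `(s_h, a_h, r_h)_{h<H}` of the nominal environment: `s_0 ∼ ν`,
`a_h ∼ π_h(· | s_h)`, `s_{h+1} ∼ P⁰_h(· | s_h, a_h)`, and given the states and actions the observed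
rewards are independent with `r_h ∼ N(r_h(s_h,a_h), 1)`. -/
def trajLaw (M : LinearDRMDP φ H) (ν : Distr S) (π : Policy S A) : Measure (Fin H → S × A × ℝ) :=
  ∑ p : Fin H → S × A, ENNReal.ofReal (pathProb ν π M.nominal p) •
    (Measure.pi fun h : Fin H => gaussianReal (M.reward h (p h).1 (p h).2) 1).map
      fun r h => ((p h).1, (p h).2, r h)

/-- The law of the offline data set: `K` i.i.d. trajectories. -/
def dataLaw (M : LinearDRMDP φ H) (ν : Distr S) (π : Policy S A) (K : ℕ) :
    Measure (Dataset S A H K) :=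
  Measure.pi fun _ => M.trajLaw ν π

/-- The minimax risk `inf_{π̂} sup_{M ∈ 𝓜} 𝔼_{D ∼ M}[SubOpt(M, π̂(D), s, ρ)]`, where `π̂` ranges over
all measurable maps from data sets of `K` trajectories to policies. -/
def minimaxRisk (𝓜 : Set (LinearDRMDP φ H)) (ρ : ℕ → ℝ) (ν : Distr S) (πb : Policy S A) (K : ℕ) (s : S) :
    ℝ≥0∞ :=
  ⨅ (πhat : Dataset S A H K → Policy S A) (_ : Measurable πhat),
    ⨆ M ∈ 𝓜, ∫⁻ D, ENNReal.ofReal (M.subOpt ρ (πhat D) s) ∂(M.dataLaw ν πb K)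

/-- The lower bound `inf_{π̂} sup_{M ∈ 𝓜} 𝔼_M[SubOpt(M, π̂(D), s, ρ)] ≥ c · Φ` for all initial states
`s ∈ T`, for the class `𝓜` and a data set of `K` trajectories collected with the behavior policy `πb`
and the initial distribution `ν`. The class is nonempty, all its members satisfy the feature coverage
assumption and have an optimal robust policy. Whichever member generates the data and whatever the
regularization parameter is, with probability at least `1 - δ` the bound holds with the uncertainty
function `Φ` of every member of the class and of every optimal robust policy of that member. -/
def HasLowerBound (𝓜 : Set (LinearDRMDP φ H)) (ρ : ℕ → ℝ) (ν : Distr S) (πb : Policy S A) (K : ℕ)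
    (T : Set S) (c δ : ℝ) : Prop :=
  𝓜.Nonempty ∧
  (∀ M ∈ 𝓜, ∀ h < H, (M.featureCov ν πb h).PosDef) ∧
  (∀ M ∈ 𝓜, ∃ π, M.IsOptimal ρ π) ∧
  ∀ lam > (0 : ℝ), ∀ M₀ ∈ 𝓜,
    ENNReal.ofReal (1 - δ) ≤ M₀.dataLaw ν πb K
      {D | ∀ s ∈ T, ∀ M ∈ 𝓜, ∀ π, M.IsOptimal ρ π →
        ENNReal.ofReal (c * M.uncertainty ρ lam D π s) ≤ minimaxRisk 𝓜 ρ ν πb K s}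

end

end LinearDRMDP

section HardInstances

/-- The point mass at `x`. -/
def dirac {S : Type*} [Fintype S] [DecidableEq S] (x : S) : Distr S :=
  ⟨Pi.single x 1, single_mem_stdSimplex ℝ x⟩

/-- The uniform distribution on a nonempty finite set. -/
def uniform (S : Type*) [Fintype S] [Nonempty S] : Distr S :=
  ⟨fun _ => (Fintype.card S : ℝ)⁻¹, fun _ => by positivity, by simp⟩

/-- The feature map of the hard instances. The states are `x₁ = 0` and `x₂ = 1`, the actions are the
elements of `{0,1}^d`, and `φ(x₁,a) = (a₁/d, …, a_d/d, 1 - ∑ᵢ aᵢ/d, 0)`, `φ(x₂,a) = (0, …, 0, 1)`. -/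
def hardFeature (d : ℕ) (s : Fin 2) (a : Fin d → Bool) : Distr (Fin (d + 2)) :=
  if s = 0 then
    ⟨Fin.snoc (α := fun _ => ℝ) (Fin.snoc (α := fun _ => ℝ)
        (fun i : Fin d => (if a i then (1 : ℝ) else 0) / d)
        (1 - ∑ i : Fin d, (if a i then (1 : ℝ) else 0) / d)) 0, by
      have hle : ∑ i : Fin d, (if a i then (1 : ℝ) else 0) / d ≤ 1 := by
        calc ∑ i : Fin d, (if a i then (1 : ℝ) else 0) / d ≤ ∑ _i : Fin d, (1 : ℝ) / d := by
              gcongr with i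
              split_ifs <;> norm_num
          _ ≤ 1 := by
              simp only [Finset.sum_const, Finset.card_univ, Fintype.card_fin, nsmul_eq_mul]
              rw [mul_one_div]
              exact div_self_le_one _
      refine ⟨fun j => ?_, by simp [Fin.sum_univ_castSucc]⟩
      refine Fin.lastCases (by simp) (fun j => ?_) j
      refine Fin.lastCases (by simpa using hle) (fun i => ?_) j
      simp only [Fin.snoc_castSucc]
      split_ifs <;> positivity⟩
  else dirac (Fin.last (d + 1))

/-- The initial distribution: `(d+1)/(d+2)` on `x₁` and `1/(d+2)` on `x₂`. -/
def hardInit (d : ℕ) : Distr (Fin 2) :=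
  ⟨![((d : ℝ) + 1) / (d + 2), 1 / ((d : ℝ) + 2)], by
    refine ⟨fun s => ?_, ?_⟩
    · fin_cases s <;> simp <;> positivity
    · simp only [Fin.sum_univ_two, Matrix.cons_val_zero, Matrix.cons_val_one]
      field_simp
      ring⟩

/-- The behavior policy: at every step and state, uniform on `{e₁, …, e_d, 0}`. -/
def hardBehavior (d : ℕ) : Policy (Fin 2) (Fin d → Bool) := fun _ _ =>
  mix (uniform (Option (Fin d))) fun o =>
    match o with
    | none => dirac fun _ => false
    | some i => dirac fun j => decide (j = i)

/-- `M` is the hard instance with sign vectors `ξ_h ∈ {-1,1}^d` (`true` stands for `1`) and scale `η`: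
`θ_h = η ((ξ_{h1}+1)/2, …, (ξ_{hd}+1)/2, 1/2, 0)` and nominal factors `(δ_{x₁}, …, δ_{x₁}, δ_{x₂})`. -/
def IsHardInstance {d H : ℕ} (η : ℝ) (ξ : ℕ → Fin d → Bool)
    (M : LinearDRMDP (hardFeature d) H) : Prop :=
  (∀ h, M.θ h = Fin.snoc (α := fun _ => ℝ) (Fin.snoc (α := fun _ => ℝ)
    (fun i : Fin d => η * ((if ξ h i then (1 : ℝ) else -1) + 1) / 2) (η / 2)) 0) ∧
  (∀ h, M.μ h = Fin.snoc (α := fun _ => Distr (Fin 2)) (fun _ : Fin (d + 1) => dirac 0) (dirac 1))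

/-- The class of all hard instances with scale `η`. -/
def hardClass (d H : ℕ) (η : ℝ) : Set (LinearDRMDP (hardFeature d) H) :=
  {M | ∃ ξ, IsHardInstance η ξ M}

end HardInstances

end DRMDP

end

/-!
Both classes are families of models indexed by sign vectors `ξ_h ∈ {-1, 1}^d`, in which the reward at
step `h` in the state `s` is `u s * η * (1/2 + ∑ᵢ aᵢ ξ_{h i} / (2d))` and the transitions do not depend
on `ξ`. They are treated together as an `IsSignFamily`. The hypotheses say that some kernels `W` of the
uncertainty set have the weight `u` as an eigenfunction at every step, and are the worst for `u`. Then
the robust control problem decouples: the optimal robust value is a multiple of `u`, it is attained by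
playing `ξ_h`, and the suboptimality of a policy is at least its expected loss under `W`, which is a sum
over the bits `(h, i)` of `η / (2d)` times the probability that the action misses the bit
(`IsSignFamily.le_subOpt`). The eigenvalues of `W` have products at least `1/4`, so the states with
rewards keep a constant share of the mass.

The minimax risk is bounded by Assouad's method (`assouad`). A flip of the bit `(h, i)` changes the
observed Gaussian rewards only on the trajectories that play `e_i` at step `h`, and only by `η / d`. The
likelihood ratio of two data sets is an explicit product of Gaussian shift densities, and the affinity
`∫ √L` tensorizes; for `η² = d³ / (2K)` it is at least `15/16`, so that no test identifies the bit
(`LinearDRMDP.two_point_bound_dataLaw`, `IsSignFamily.two_point`). Summation over the `H d` bits gives a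
risk of the order `H η` (`IsSignFamily.le_minimaxRisk`).

The uncertainty function is of the order `H η` with high probability. The optimal value has variance
zero under the nominal kernels, so the covariance is not reweighted. The state has the law `hardInit` at
every step, and a Chernoff bound shows that the pairs `(x₁, e_i)`, `(x₁, 0)`, `(x₂, 0)` are visited at
least half as often as expected. Since the `i`-th unit vector is `d φ(x₁, e_i) - (d - 1) φ(x₁, 0)`, the
diagonal of the inverse covariance is at most `12 d³ / K` (`sq_coord_le`,
`IsSignFamily.uncertainty_le`), and the features have sum one.

For the class with the given features, `u` is the indicator of `x₁`, and the worst kernel moves the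
mass `ρ` from `x₁` to the absorbing state at the first step. From `x₂` nothing can be lost there. For a
bound in both states and with the level `ρ` at every step, the features at `x₂` are those at `x₁` with
the last two coordinates exchanged, and all factor distributions equal `hardInit`. Then the rewards are
the same in both states and the transitions are irrelevant: `u = 1` and all eigenvalues are `1`.
-/

noncomputable section

namespace DRMDP

/-! ### Product measures and the two-point bound -/

section ProductMeasures

variable {ι : Type*} [Fintype ι] {X : ι → Type*} [∀ i, MeasurableSpace (X i)]

lemma lintegral_pi_prod (μ : ∀ i, Measure (X i)) [∀ i, IsProbabilityMeasure (μ i)]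
    {f : ∀ i, X i → ℝ≥0∞} (hf : ∀ i, Measurable (f i)) :
    ∫⁻ x, ∏ i, f i (x i) ∂Measure.pi μ = ∏ i, ∫⁻ x, f i x ∂μ i := by
  have hind : iIndepFun (fun i (x : ∀ i, X i) => f i (x i)) (Measure.pi μ) :=
    iIndepFun_pi fun i => (hf i).aemeasurable
  rw [lintegral_prod_eq_prod_lintegral_of_indepFun Finset.univ _ hind
    fun i => (hf i).comp (measurable_pi_apply i)]
  exact Finset.prod_congr rfl fun i _ => (measurePreserving_eval μ i).lintegral_comp (hf i)

lemma pi_eq_withDensity {μ ν : ∀ i, Measure (X i)} [∀ i, IsProbabilityMeasure (μ i)]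
    [∀ i, IsProbabilityMeasure (ν i)] {f : ∀ i, X i → ℝ≥0∞} (hf : ∀ i, Measurable (f i))
    (h : ∀ i, ν i = (μ i).withDensity (f i)) :
    Measure.pi ν = (Measure.pi μ).withDensity fun x => ∏ i, f i (x i) := by
  refine Measure.pi_eq fun s hs => ?_
  rw [withDensity_apply _ (MeasurableSet.univ_pi hs),
    ← lintegral_indicator (MeasurableSet.univ_pi hs)]
  have : ∀ x : ∀ i, X i, (Set.univ.pi s).indicator (fun x => ∏ i, f i (x i)) x
      = ∏ i, (s i).indicator (f i) (x i) := by
    intro x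
    by_cases hx : x ∈ Set.univ.pi s
    · rw [Set.indicator_of_mem hx]
      exact Finset.prod_congr rfl fun i _ => (Set.indicator_of_mem (hx i trivial) _).symm
    · rw [Set.indicator_of_notMem hx]
      simp only [Set.mem_univ_pi, not_forall] at hx
      obtain ⟨i, hi⟩ := hx
      exact (Finset.prod_eq_zero (Finset.mem_univ i) (Set.indicator_of_notMem hi _)).symm
  simp_rw [this]
  rw [lintegral_pi_prod μ fun i => (hf i).indicator (hs i)]
  refine Finset.prod_congr rfl fun i _ => ?_
  rw [lintegral_indicator (hs i), h i, withDensity_apply _ (hs i)]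

end ProductMeasures

/-- The density of `N(m + t, 1)` with respect to `N(m, 1)`. -/
def shiftDensity (m t x : ℝ) : ℝ := Real.exp (t * (x - m) - t ^ 2 / 2)

lemma shiftDensity_nonneg (m t x : ℝ) : 0 ≤ shiftDensity m t x := (Real.exp_pos _).le

@[fun_prop]
lemma measurable_shiftDensity (m t : ℝ) : Measurable (shiftDensity m t) := by
  unfold shiftDensity; fun_prop

lemma gaussianReal_add_eq_withDensity (m t : ℝ) :
    gaussianReal (m + t) 1
      = (gaussianReal m 1).withDensity fun x => ENNReal.ofReal (shiftDensity m t x) := by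
  rw [gaussianReal_of_var_ne_zero _ one_ne_zero, gaussianReal_of_var_ne_zero _ one_ne_zero,
    ← withDensity_mul _ (measurable_gaussianPDF _ _) (by fun_prop)]
  congr 1
  funext x
  simp only [Pi.mul_apply, gaussianPDF]
  rw [← ENNReal.ofReal_mul (gaussianPDFReal_nonneg _ _ _)]
  congr 1
  simp only [gaussianPDFReal, shiftDensity]
  rw [mul_assoc _ (Real.exp _), ← Real.exp_add]
  congr 2
  simp only [NNReal.coe_one]
  ring

lemma lintegral_shiftDensity (m t : ℝ) :
    ∫⁻ x, ENNReal.ofReal (shiftDensity m t x) ∂gaussianReal m 1 = 1 := by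
  have h := measure_univ (μ := gaussianReal (m + t) 1)
  rwa [gaussianReal_add_eq_withDensity, withDensity_apply _ MeasurableSet.univ,
    Measure.restrict_univ] at h

/-- The Hellinger affinity of `N(m, 1)` and `N(m + t, 1)` is `exp (-t² / 8)`. -/
lemma lintegral_sqrt_shiftDensity (m t : ℝ) :
    ∫⁻ x, ENNReal.ofReal √(shiftDensity m t x) ∂gaussianReal m 1
      = ENNReal.ofReal (Real.exp (-(t ^ 2 / 8))) := by
  have : ∀ x, √(shiftDensity m t x) = Real.exp (-(t ^ 2 / 8)) * shiftDensity m (t / 2) x := by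
    intro x
    rw [shiftDensity, shiftDensity, ← Real.exp_half, ← Real.exp_add]
    congr 1
    ring
  simp_rw [this, ENNReal.ofReal_mul (Real.exp_pos _).le]
  rw [lintegral_const_mul _ (by fun_prop), lintegral_shiftDensity, mul_one]

/-- Le Cam's two-point bound. If `ν` has the density `L` with respect to `μ`, the affinity `∫ √L dμ`
controls from below the sum of the two errors of any test. -/
lemma two_point_bound {Ω : Type*} [MeasurableSpace Ω] {μ ν : Measure Ω} [IsProbabilityMeasure μ]
    [IsProbabilityMeasure ν] {L : Ω → ℝ} (hL : Measurable L) (hL0 : ∀ x, 0 ≤ L x)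
    (hν : ν = μ.withDensity fun x => ENNReal.ofReal (L x)) {f g : Ω → ℝ} (hf : Measurable f)
    (hg : Measurable g) (hf0 : ∀ x, 0 ≤ f x) (hg0 : ∀ x, 0 ≤ g x) {κ A : ℝ} (hκ : 0 ≤ κ)
    (hfg : ∀ x, κ ≤ f x + g x)
    (hA : ENNReal.ofReal A ≤ ∫⁻ x, ENNReal.ofReal √(L x) ∂μ) :
    ENNReal.ofReal (κ * (A - 1 / 2))
      ≤ ∫⁻ x, ENNReal.ofReal (f x) ∂μ + ∫⁻ x, ENNReal.ofReal (g x) ∂ν := by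
  have hL1 : ∫⁻ x, ENNReal.ofReal (L x) ∂μ = 1 := by
    have h := measure_univ (μ := ν)
    rwa [hν, withDensity_apply _ MeasurableSet.univ, Measure.restrict_univ] at h
  have hpt : ∀ x, κ * √(L x) ≤ f x + L x * g x + κ / 4 * (1 + L x) := by
    intro x
    have h0 := Real.sqrt_nonneg (L x)
    have h2 := Real.sq_sqrt (hL0 x)
    set t := √(L x)
    rw [← h2]
    -- `min 1 t² + (1 + t²) / 4 ≥ t`
    rcases le_total t 1 with ht | ht
    · have h1 : t ^ 2 ≤ 1 := by nlinarith
      nlinarith [mul_le_mul_of_nonneg_left (hfg x) (sq_nonneg t), mul_nonneg (sub_nonneg.2 h1) (hf0 x),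
        mul_nonneg hκ (mul_nonneg h0 h0), mul_nonneg hκ (sq_nonneg (t * 5 / 2 - 1)),
        mul_nonneg hκ (sq_nonneg (t - 1 / 2)), sq_nonneg t]
    · have h1 : 1 ≤ t ^ 2 := by nlinarith
      nlinarith [hfg x, mul_nonneg (sub_nonneg.2 h1) (hg0 x), mul_nonneg hκ (sq_nonneg (t - 2))]
  have hint : ∫⁻ x, ENNReal.ofReal (κ * √(L x)) ∂μ
      ≤ (∫⁻ x, ENNReal.ofReal (f x) ∂μ + ∫⁻ x, ENNReal.ofReal (g x) ∂ν)
        + ENNReal.ofReal (κ / 2) := by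
    calc ∫⁻ x, ENNReal.ofReal (κ * √(L x)) ∂μ
        ≤ ∫⁻ x, (ENNReal.ofReal (f x) + ENNReal.ofReal (L x) * ENNReal.ofReal (g x))
            + ENNReal.ofReal (κ / 4) * (1 + ENNReal.ofReal (L x)) ∂μ := by
          refine lintegral_mono fun x => ?_
          rw [← ENNReal.ofReal_mul (hL0 x), ← ENNReal.ofReal_one,
            ← ENNReal.ofReal_add zero_le_one (hL0 x), ← ENNReal.ofReal_mul (by positivity),
            ← ENNReal.ofReal_add (hf0 x) (mul_nonneg (hL0 x) (hg0 x)),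
            ← ENNReal.ofReal_add
              (add_nonneg (hf0 x) (mul_nonneg (hL0 x) (hg0 x)))
              (mul_nonneg (by positivity) (by linarith [hL0 x]))]
          exact ENNReal.ofReal_le_ofReal (hpt x)
      _ = _ := by
          rw [lintegral_add_left (by fun_prop), lintegral_add_left (by fun_prop),
            lintegral_const_mul _ (by fun_prop), lintegral_add_left (by fun_prop), hL1, hν,
            lintegral_withDensity_eq_lintegral_mul _ (by fun_prop) (by fun_prop)]
          simp only [Pi.mul_apply, lintegral_one, measure_univ]
          rw [← ENNReal.ofReal_one, ← ENNReal.ofReal_add zero_le_one zero_le_one,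
            ← ENNReal.ofReal_mul (by positivity)]
          congr 2
          ring
  simp_rw [ENNReal.ofReal_mul hκ] at hint
  rw [lintegral_const_mul _ (by fun_prop)] at hint
  have h1 : ENNReal.ofReal (κ * A) ≤ (∫⁻ x, ENNReal.ofReal (f x) ∂μ
      + ∫⁻ x, ENNReal.ofReal (g x) ∂ν) + ENNReal.ofReal (κ / 2) := by
    rw [ENNReal.ofReal_mul hκ]
    exact (mul_le_mul_right hA _).trans hint
  rw [show κ * (A - 1 / 2) = κ * A - κ / 2 by ring, ENNReal.ofReal_sub _ (by positivity)]
  exact tsub_le_iff_right.2 h1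

/-! ### Markov chains -/

section MarkovChain

variable {S A : Type*} [Fintype S] [Fintype A]

lemma Distr.sum_mul_const {T : Type*} [Fintype T] (p : Distr T) (c : ℝ) : ∑ t, p.1 t * c = c := by
  rw [← Finset.sum_mul, p.2.2, one_mul]

lemma Distr.sum_mul_le {T : Type*} [Fintype T] (p : Distr T) {f : T → ℝ} {B : ℝ}
    (h : ∀ t, f t ≤ B) : ∑ t, p.1 t * f t ≤ B := by
  rw [← p.sum_mul_const B]
  exact Finset.sum_le_sum fun t _ => mul_le_mul_of_nonneg_left (h t) (p.2.1 t)

lemma Distr.le_sum_mul {T : Type*} [Fintype T] (p : Distr T) {f : T → ℝ} {B : ℝ}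
    (h : ∀ t, B ≤ f t) : B ≤ ∑ t, p.1 t * f t := by
  rw [← p.sum_mul_const B]
  exact Finset.sum_le_sum fun t _ => mul_le_mul_of_nonneg_left (h t) (p.2.1 t)

lemma stateLaw_succ_eq_stateLaw_one (π : Policy S A) (P : Transition S A) (h : ℕ) (ν : S → ℝ)
    (k : ℕ) : stateLaw π P h ν (k + 1) = stateLaw π P (h + 1) (stateLaw π P h ν 1) k := by
  induction k with
  | zero => rfl
  | succ k ih =>
    rw [stateLaw, ih]
    funext s'
    have e : h + (k + 1) = h + 1 + k := by omega
    rw [e]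
    rfl

lemma stateLaw_eq_sum [DecidableEq S] (π : Policy S A) (P : Transition S A) (h : ℕ) (ν : S → ℝ)
    (k : ℕ) (s' : S) :
    stateLaw π P h ν k s' = ∑ s, ν s * stateLaw π P h (Pi.single s 1) k s' := by
  induction k generalizing s' with
  | zero => simp [stateLaw, Pi.single_apply]
  | succ k ih =>
    simp only [stateLaw]
    simp_rw [ih, Finset.sum_mul, Finset.mul_sum]
    rw [Finset.sum_congr rfl fun s _ => Finset.sum_comm, Finset.sum_comm]
    refine Finset.sum_congr rfl fun s _ => Finset.sum_congr rfl fun s' _ =>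
      Finset.sum_congr rfl fun a _ => ?_
    ring

lemma expect_succ [DecidableEq S] (π : Policy S A) (P : Transition S A) (h : ℕ) (ν : S → ℝ) (k : ℕ)
    (f : S → A → ℝ) :
    expect π P h ν (k + 1) f
      = ∑ s, ∑ a, ν s * (π h s).1 a
          * ∑ s', (P h s a).1 s' * expect π P (h + 1) (Pi.single s' 1) k f := by
  have h1 : expect π P h ν (k + 1) f
      = ∑ s', stateLaw π P h ν 1 s' * expect π P (h + 1) (Pi.single s' 1) k f := by
    simp only [expect]
    rw [stateLaw_succ_eq_stateLaw_one, show h + (k + 1) = h + 1 + k by omega]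
    simp_rw [stateLaw_eq_sum π P (h + 1) (stateLaw π P h ν 1) k, Finset.sum_mul, Finset.mul_sum]
    rw [Finset.sum_congr rfl fun s _ => Finset.sum_comm, Finset.sum_comm]
    refine Finset.sum_congr rfl fun s _ => Finset.sum_congr rfl fun s' _ =>
      Finset.sum_congr rfl fun a _ => ?_
    ring
  rw [h1]
  simp only [stateLaw, add_zero]
  simp_rw [Finset.sum_mul, Finset.mul_sum]
  rw [Finset.sum_comm]
  refine Finset.sum_congr rfl fun s _ => ?_
  rw [Finset.sum_comm]
  refine Finset.sum_congr rfl fun a _ => Finset.sum_congr rfl fun s' _ => ?_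
  ring

lemma expect_single_zero [DecidableEq S] (π : Policy S A) (P : Transition S A) (h : ℕ) (s : S)
    (f : S → A → ℝ) :
    expect π P h (Pi.single s 1) 0 f = ∑ a, (π h s).1 a * f s a := by
  simp only [expect, stateLaw, add_zero]
  rw [Finset.sum_eq_single s]
  · simp
  · intro b _ hb
    simp [Pi.single_eq_of_ne hb]
  · simp

lemma expect_single_succ [DecidableEq S] (π : Policy S A) (P : Transition S A) (h : ℕ) (s : S)
    (k : ℕ) (f : S → A → ℝ) :
    expect π P h (Pi.single s 1) (k + 1) f
      = ∑ a, (π h s).1 a * ∑ s', (P h s a).1 s' * expect π P (h + 1) (Pi.single s' 1) k f := by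
  rw [expect_succ, Finset.sum_eq_single s]
  · simp
  · intro b _ hb
    simp [Pi.single_eq_of_ne hb]
  · simp

lemma value_of_le [DecidableEq S] {H : ℕ} (r : ℕ → S → A → ℝ) (π : Policy S A) (P : Transition S A)
    {h : ℕ} (hh : H ≤ h) (s : S) : value H r π P h s = 0 := by
  simp [value, Nat.sub_eq_zero_of_le hh]

/-- The Bellman equation of a fixed policy and fixed kernels. -/
lemma value_eq [DecidableEq S] {H : ℕ} (r : ℕ → S → A → ℝ) (π : Policy S A) (P : Transition S A)
    {h : ℕ} (hh : h < H) (s : S) :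
    value H r π P h s
      = ∑ a, (π h s).1 a * (r h s a + ∑ s', (P h s a).1 s' * value H r π P (h + 1) s') := by
  simp only [value]
  rw [show H - h = (H - (h + 1)) + 1 by omega, Finset.sum_range_succ']
  simp only [add_zero]
  rw [expect_single_zero]
  simp_rw [expect_single_succ, mul_add, Finset.sum_add_distrib]
  rw [add_comm]
  congr 1
  rw [Finset.sum_comm]
  refine Finset.sum_congr rfl fun a _ => ?_
  rw [← Finset.mul_sum, Finset.sum_comm]
  congr 1
  refine Finset.sum_congr rfl fun s' _ => ?_
  rw [Finset.mul_sum]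
  refine Finset.sum_congr rfl fun k _ => ?_
  rw [show h + (k + 1) = h + 1 + k by omega]

lemma stateLaw_mem (π : Policy S A) (P : Transition S A) (h : ℕ) (ν : Distr S) (k : ℕ) :
    stateLaw π P h ν.1 k ∈ stdSimplex ℝ S := by
  induction k with
  | zero => exact ν.2
  | succ k ih =>
    refine ⟨fun s' => Finset.sum_nonneg fun s _ => Finset.sum_nonneg fun a _ =>
      mul_nonneg (mul_nonneg (ih.1 s) ((π (h + k) s).2.1 a)) ((P (h + k) s a).2.1 s'), ?_⟩
    simp only [stateLaw]
    rw [Finset.sum_comm]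
    rw [← ih.2]
    refine Finset.sum_congr rfl fun s _ => ?_
    rw [Finset.sum_comm]
    simp_rw [← Finset.mul_sum, (P _ _ _).2.2, mul_one, ← Finset.mul_sum, (π _ _).2.2, mul_one]

lemma expect_le (π : Policy S A) (P : Transition S A) (h : ℕ) (ν : Distr S) (k : ℕ)
    {f : S → A → ℝ} {B : ℝ} (hf : ∀ s a, f s a ≤ B) : expect π P h ν.1 k f ≤ B := by
  have : expect π P h ν.1 k f
      = ∑ s, stateLaw π P h ν.1 k s * ∑ a, (π (h + k) s).1 a * f s a := by
    simp only [expect, Finset.mul_sum, mul_assoc]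
  rw [this]
  exact Distr.sum_mul_le ⟨_, stateLaw_mem π P h ν k⟩ fun s => Distr.sum_mul_le _ (hf s)

/-! ### Marginals of the path law -/

lemma pathProb_nonneg {H : ℕ} (ν : Distr S) (π : Policy S A) (P : Transition S A)
    (p : Fin H → S × A) : 0 ≤ pathProb ν π P p := by
  refine Finset.prod_nonneg fun h _ => mul_nonneg ?_ ((π _ _).2.1 _)
  split_ifs
  · exact ν.2.1 _
  · exact (P _ _ _).2.1 _

/-- A path of length at least one is extended by one step with the transition kernel and the policy. -/
lemma pathProb_snoc {H : ℕ} (ν : Distr S) (π : Policy S A) (P : Transition S A)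
    (p : Fin (H + 1) → S × A) (x : S × A) :
    pathProb ν π P (Fin.snoc (α := fun _ => S × A) p x)
      = pathProb ν π P p * ((P H (p (Fin.last H)).1 (p (Fin.last H)).2).1 x.1
          * (π (H + 1) x.1).1 x.2) := by
  have e : ∀ (k : ℕ) (hk : k < H + 1) (hk' : k < H + 1 + 1),
      (Fin.snoc (α := fun _ => S × A) p x : Fin (H + 1 + 1) → S × A) ⟨k, hk'⟩ = p ⟨k, hk⟩ := by
    intro k hk hk'
    exact Fin.snoc_castSucc (α := fun _ => S × A) x p ⟨k, hk⟩
  simp only [pathProb]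
  rw [Fin.prod_univ_castSucc]
  congr 1
  · refine Finset.prod_congr rfl fun h _ => ?_
    simp only [Fin.snoc_castSucc, Fin.val_castSucc]
    rw [e (h.1 - 1) (by omega)]
  · simp only [Fin.snoc_last, Fin.val_last]
    rw [if_neg (by omega), e (H + 1 - 1) (by omega)]
    rfl

lemma sum_path_snoc {X : Type*} [Fintype X] {H : ℕ} (F : (Fin (H + 1) → X) → ℝ) :
    ∑ p, F p = ∑ p : Fin H → X, ∑ x, F (Fin.snoc (α := fun _ => X) p x) := by
  rw [← (Fin.snocEquiv fun _ : Fin (H + 1) => X).sum_comp, Fintype.sum_prod_type, Finset.sum_comm]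
  rfl

lemma sum_pathProb_last (ν : Distr S) (π : Policy S A) (P : Transition S A) (H : ℕ)
    (F : S → A → ℝ) :
    ∑ p : Fin (H + 1) → S × A, pathProb ν π P p * F (p (Fin.last H)).1 (p (Fin.last H)).2
      = expect π P 0 ν.1 H F := by
  induction H generalizing F with
  | zero =>
    have e : ∀ x : S × A, (Fin.snoc (α := fun _ => S × A) default x : Fin 1 → S × A) 0 = x :=
      fun x => Fin.snoc_last (α := fun _ => S × A) x default
    rw [sum_path_snoc, Fintype.sum_unique, Fintype.sum_prod_type]
    simp [expect, stateLaw, pathProb, e]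
  | succ H ih =>
    rw [sum_path_snoc]
    simp only [pathProb_snoc, Fin.snoc_last]
    have := ih fun s a => ∑ x : S × A, (P H s a).1 x.1 * (π (H + 1) x.1).1 x.2 * F x.1 x.2
    simp only [Finset.mul_sum] at this
    simp only [mul_assoc] at this ⊢
    rw [this]
    have e : expect π P 0 ν.1 (H + 1) F
        = ∑ x : S × A, ∑ y : S × A, stateLaw π P 0 ν.1 H y.1 * (π H y.1).1 y.2
            * (P H y.1 y.2).1 x.1 * (π (H + 1) x.1).1 x.2 * F x.1 x.2 := by
      simp only [expect, stateLaw, zero_add, Fintype.sum_prod_type, Finset.sum_mul]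
    rw [e, Finset.sum_comm]
    simp only [expect, zero_add, Finset.mul_sum, Fintype.sum_prod_type, mul_assoc]

lemma sum_pathProb_mul {H : ℕ} (ν : Distr S) (π : Policy S A) (P : Transition S A) (h : Fin H)
    (F : S → A → ℝ) :
    ∑ p : Fin H → S × A, pathProb ν π P p * F (p h).1 (p h).2 = expect π P 0 ν.1 h F := by
  induction H with
  | zero => exact h.elim0
  | succ H ih =>
    refine Fin.lastCases (sum_pathProb_last ν π P H F) (fun h => ?_) h
    obtain ⟨H, rfl⟩ : ∃ k, H = k + 1 := ⟨H - 1, by have := h.2; omega⟩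
    rw [sum_path_snoc]
    simp only [pathProb_snoc, Fin.snoc_castSucc, Fin.val_castSucc]
    rw [← ih h]
    refine Finset.sum_congr rfl fun p _ => ?_
    rw [← Finset.sum_mul, ← Finset.mul_sum, Fintype.sum_prod_type]
    simp_rw [← Finset.mul_sum, (π _ _).2.2, mul_one, (P _ _ _).2.2, mul_one]

lemma sum_pathProb (ν : Distr S) (π : Policy S A) (P : Transition S A) (H : ℕ) :
    ∑ p : Fin H → S × A, pathProb ν π P p = 1 := by
  rcases Nat.eq_zero_or_pos H with rfl | hH
  · simp [pathProb]
  · have h := sum_pathProb_mul ν π P ⟨0, hH⟩ fun _ _ => 1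
    simp only [mul_one] at h
    rw [h]
    simp only [expect, stateLaw, mul_one]
    simp_rw [← Finset.mul_sum, (π _ _).2.2, mul_one, ν.2.2]

end MarkovChain

/-! ### The law of a trajectory and its likelihood ratios -/

namespace LinearDRMDP

section Likelihood

variable {S A : Type*} [Fintype S] {n H : ℕ} {φ : S → A → Distr (Fin n)}

/-- The likelihood ratio of one trajectory under `M'` and under `M`, for two models with the same
nominal kernels: only the Gaussian rewards contribute. -/
def trajLikelihood (M M' : LinearDRMDP φ H) (x : Fin H → S × A × ℝ) : ℝ :=
  ∏ h : Fin H, shiftDensity (M.reward h (x h).1 (x h).2.1)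
    (M'.reward h (x h).1 (x h).2.1 - M.reward h (x h).1 (x h).2.1) (x h).2.2

lemma trajLikelihood_nonneg (M M' : LinearDRMDP φ H) (x : Fin H → S × A × ℝ) :
    0 ≤ trajLikelihood M M' x :=
  Finset.prod_nonneg fun _ _ => shiftDensity_nonneg _ _ _

end Likelihood

section TrajectoryLaw

variable {S A : Type*} [Fintype S] [Fintype A] [MeasurableSpace S]
  [MeasurableSpace A] {n H : ℕ} {φ : S → A → Distr (Fin n)}

lemma lintegral_trajLaw (M : LinearDRMDP φ H) (ν : Distr S) (π : Policy S A)
    {g : (Fin H → S × A × ℝ) → ℝ≥0∞} (hg : Measurable g) :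
    ∫⁻ x, g x ∂M.trajLaw ν π
      = ∑ p : Fin H → S × A, ENNReal.ofReal (pathProb ν π M.nominal p)
        * ∫⁻ r, g (fun h => ((p h).1, (p h).2, r h))
            ∂Measure.pi fun h : Fin H => gaussianReal (M.reward h (p h).1 (p h).2) 1 := by
  rw [trajLaw, lintegral_finsetSum_measure]
  refine Finset.sum_congr rfl fun p _ => ?_
  rw [lintegral_smul_measure, lintegral_map hg (by fun_prop), smul_eq_mul]

/-- Functions of the visited states and actions only are integrated with the path probabilities. -/
lemma lintegral_trajLaw_path (M : LinearDRMDP φ H) (ν : Distr S) (π : Policy S A)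
    {F : (Fin H → S × A) → ℝ} (hF : ∀ p, 0 ≤ F p)
    (hg : Measurable fun x : Fin H → S × A × ℝ =>
      ENNReal.ofReal (F fun h => ((x h).1, (x h).2.1))) :
    ∫⁻ x, ENNReal.ofReal (F fun h => ((x h).1, (x h).2.1)) ∂M.trajLaw ν π
      = ENNReal.ofReal (∑ p, pathProb ν π M.nominal p * F p) := by
  rw [lintegral_trajLaw M ν π hg, ENNReal.ofReal_sum_of_nonneg
    fun p _ => mul_nonneg (pathProb_nonneg _ _ _ _) (hF p)]
  refine Finset.sum_congr rfl fun p _ => ?_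
  rw [ENNReal.ofReal_mul (pathProb_nonneg _ _ _ _)]
  simp

instance isProbabilityMeasure_trajLaw (M : LinearDRMDP φ H) (ν : Distr S) (π : Policy S A) :
    IsProbabilityMeasure (M.trajLaw ν π) := by
  constructor
  have h := M.lintegral_trajLaw_path ν π (F := fun _ => 1) (fun _ => zero_le_one) measurable_const
  simpa [sum_pathProb] using h

instance isProbabilityMeasure_dataLaw (M : LinearDRMDP φ H) (ν : Distr S) (π : Policy S A) (K : ℕ) :
    IsProbabilityMeasure (M.dataLaw ν π K) := by
  unfold dataLaw; infer_instance

variable [DiscreteMeasurableSpace S] [DiscreteMeasurableSpace A]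

lemma measurable_of_finite_prod {β : Type*} [MeasurableSpace β] {f : S × A × ℝ → β}
    (hf : ∀ s a, Measurable fun x => f (s, a, x)) : Measurable f :=
  measurable_from_prod_countable_right fun s =>
    measurable_from_prod_countable_right fun a => hf s a

@[fun_prop]
lemma measurable_trajLikelihood (M M' : LinearDRMDP φ H) : Measurable (trajLikelihood M M') := by
  refine Finset.measurable_prod _ fun h _ => ?_
  exact (measurable_of_finite_prod (f := fun y : S × A × ℝ => shiftDensity (M.reward h y.1 y.2.1)
    (M'.reward h y.1 y.2.1 - M.reward h y.1 y.2.1) y.2.2)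
    fun s a => measurable_shiftDensity (M.reward h s a)
      (M'.reward h s a - M.reward h s a)).comp (measurable_pi_apply h)

/-- Given the path, the rewards are independent Gaussians, so the density of the rewards along the
path is a product of shift densities; the path probabilities agree and cancel. -/
lemma trajLaw_eq_withDensity {M M' : LinearDRMDP φ H} (hM : M'.nominal = M.nominal) (ν : Distr S)
    (π : Policy S A) :
    M'.trajLaw ν π
      = (M.trajLaw ν π).withDensity fun x => ENNReal.ofReal (trajLikelihood M M' x) := by
  ext s hs
  rw [withDensity_apply _ hs, ← lintegral_indicator hs, ← lintegral_indicator_one hs,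
    lintegral_trajLaw M' ν π (measurable_one.indicator hs),
    lintegral_trajLaw M ν π (by measurability)]
  refine Finset.sum_congr rfl fun p _ => ?_
  rw [hM]
  congr 1
  have h := pi_eq_withDensity
    (μ := fun h : Fin H => gaussianReal (M.reward h (p h).1 (p h).2) 1)
    (ν := fun h : Fin H => gaussianReal (M'.reward h (p h).1 (p h).2) 1)
    (f := fun h x => ENNReal.ofReal (shiftDensity (M.reward h (p h).1 (p h).2)
      (M'.reward h (p h).1 (p h).2 - M.reward h (p h).1 (p h).2) x))
    (fun h => by fun_prop)
    (fun h => by rw [← gaussianReal_add_eq_withDensity, add_sub_cancel])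
  have hm : Measurable fun r : Fin H → ℝ =>
      (fun h => ((p h).1, (p h).2, r h) : Fin H → S × A × ℝ) := by fun_prop
  have hi : Measurable fun r : Fin H → ℝ =>
      s.indicator (1 : (Fin H → S × A × ℝ) → ℝ≥0∞) fun h => ((p h).1, (p h).2, r h) :=
    (measurable_one.indicator hs).comp hm
  rw [h, lintegral_withDensity_eq_lintegral_mul _ (by fun_prop) hi]
  refine lintegral_congr fun r => ?_
  simp only [Pi.mul_apply]
  by_cases hr : (fun h => ((p h).1, (p h).2, r h)) ∈ s
  · rw [Set.indicator_of_mem hr, Set.indicator_of_mem hr, Pi.one_apply, mul_one, trajLikelihood,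
      ENNReal.ofReal_prod_of_nonneg fun _ _ => shiftDensity_nonneg _ _ _]
  · rw [Set.indicator_of_notMem hr, Set.indicator_of_notMem hr, mul_zero]

/-- The affinity of the laws of one trajectory under two models with the same nominal kernels. -/
lemma le_lintegral_sqrt_trajLikelihood (M M' : LinearDRMDP φ H) (ν : Distr S) (π : Policy S A) :
    ENNReal.ofReal (1 - (∑ h : Fin H, expect π M.nominal 0 ν.1 h fun s a =>
        (M'.reward h s a - M.reward h s a) ^ 2) / 8)
      ≤ ∫⁻ x, ENNReal.ofReal √(trajLikelihood M M' x) ∂M.trajLaw ν π := by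
  rw [lintegral_trajLaw M ν π (by fun_prop)]
  have key : ∀ p : Fin H → S × A,
      ∫⁻ r, ENNReal.ofReal √(trajLikelihood M M' fun h => ((p h).1, (p h).2, r h))
        ∂Measure.pi (fun h : Fin H => gaussianReal (M.reward h (p h).1 (p h).2) 1)
      = ENNReal.ofReal (Real.exp
          (-((∑ h : Fin H, (M'.reward h (p h).1 (p h).2 - M.reward h (p h).1 (p h).2) ^ 2) / 8))) := by
    intro p
    simp only [trajLikelihood]
    have e : ∀ r : Fin H → ℝ, ENNReal.ofReal √(∏ h : Fin H, shiftDensity (M.reward h (p h).1 (p h).2)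
          (M'.reward h (p h).1 (p h).2 - M.reward h (p h).1 (p h).2) (r h))
        = ∏ h : Fin H, ENNReal.ofReal √(shiftDensity (M.reward h (p h).1 (p h).2)
          (M'.reward h (p h).1 (p h).2 - M.reward h (p h).1 (p h).2) (r h)) := fun r => by
      rw [Real.sqrt_prod _ fun _ _ => shiftDensity_nonneg _ _ _,
        ENNReal.ofReal_prod_of_nonneg fun _ _ => Real.sqrt_nonneg _]
    simp_rw [e]
    rw [lintegral_pi_prod (fun h : Fin H => gaussianReal (M.reward h (p h).1 (p h).2) 1)
      (f := fun h x => ENNReal.ofReal √(shiftDensity (M.reward h (p h).1 (p h).2)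
        (M'.reward h (p h).1 (p h).2 - M.reward h (p h).1 (p h).2) x)) (fun h => by fun_prop)]
    simp_rw [lintegral_sqrt_shiftDensity]
    rw [← ENNReal.ofReal_prod_of_nonneg fun _ _ => (Real.exp_pos _).le, ← Real.exp_sum,
      Finset.sum_neg_distrib, Finset.sum_div]
  simp_rw [key, ← ENNReal.ofReal_mul (pathProb_nonneg _ _ _ _)]
  rw [← ENNReal.ofReal_sum_of_nonneg
    fun p _ => mul_nonneg (pathProb_nonneg _ _ _ _) (Real.exp_pos _).le]
  refine ENNReal.ofReal_le_ofReal ?_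
  have h1 : (∑ h : Fin H, expect π M.nominal 0 ν.1 h fun s a =>
        (M'.reward h s a - M.reward h s a) ^ 2)
      = ∑ p : Fin H → S × A, pathProb ν π M.nominal p
          * ∑ h : Fin H, (M'.reward h (p h).1 (p h).2 - M.reward h (p h).1 (p h).2) ^ 2 := by
    simp_rw [Finset.mul_sum]
    rw [Finset.sum_comm]
    refine Finset.sum_congr rfl fun h _ => ?_
    rw [← sum_pathProb_mul]
  rw [h1, Finset.sum_div, ← sum_pathProb ν π M.nominal H, ← Finset.sum_sub_distrib]
  refine Finset.sum_le_sum fun p _ => ?_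
  rw [mul_div_assoc, ← mul_one_sub]
  refine mul_le_mul_of_nonneg_left ?_ (pathProb_nonneg _ _ _ _)
  have := Real.add_one_le_exp
    (-((∑ h : Fin H, (M'.reward h (p h).1 (p h).2 - M.reward h (p h).1 (p h).2) ^ 2) / 8))
  linarith

/-- Le Cam's bound for the data sets of two models with the same nominal kernels. -/
lemma two_point_bound_dataLaw {M M' : LinearDRMDP φ H} (hM : M'.nominal = M.nominal) (ν : Distr S)
    (π : Policy S A) {K : ℕ} {f g : Dataset S A H K → ℝ} (hf : Measurable f)
    (hg : Measurable g) (hf0 : ∀ x, 0 ≤ f x) (hg0 : ∀ x, 0 ≤ g x) {κ B : ℝ} (hκ : 0 ≤ κ)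
    (hfg : ∀ x, κ ≤ f x + g x)
    (hB : (∑ h : Fin H, expect π M.nominal 0 ν.1 h fun s a =>
        (M'.reward h s a - M.reward h s a) ^ 2) ≤ B) (hB8 : B ≤ 8) :
    ENNReal.ofReal (κ * (1 / 2 - K * (B / 8)))
      ≤ ∫⁻ x, ENNReal.ofReal (f x) ∂M.dataLaw ν π K
        + ∫⁻ x, ENNReal.ofReal (g x) ∂M'.dataLaw ν π K := by
  have hpos : ∀ D : Dataset S A H K, 0 ≤ ∏ τ, trajLikelihood M M' (D τ) :=
    fun D => Finset.prod_nonneg fun τ _ => trajLikelihood_nonneg M M' _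
  have hmeas : Measurable fun D : Dataset S A H K => ∏ τ, trajLikelihood M M' (D τ) := by
    fun_prop
  have h := two_point_bound (μ := M.dataLaw ν π K) (ν := M'.dataLaw ν π K)
    (L := fun D => ∏ τ, trajLikelihood M M' (D τ)) hmeas hpos
    (by
      rw [dataLaw, dataLaw, pi_eq_withDensity (f := fun _ x => ENNReal.ofReal (trajLikelihood M M' x))
        (fun _ => by fun_prop) (fun _ => trajLaw_eq_withDensity hM ν π)]
      congr 1
      funext D
      rw [ENNReal.ofReal_prod_of_nonneg fun τ _ => trajLikelihood_nonneg M M' _])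
    hf hg hf0 hg0 hκ hfg (A := 1 - K * (B / 8)) ?_
  · rwa [show 1 - K * (B / 8) - 1 / 2 = 1 / 2 - K * (B / 8) by ring] at h
  · have e : ∀ D : Dataset S A H K, ENNReal.ofReal √(∏ τ, trajLikelihood M M' (D τ))
        = ∏ τ, ENNReal.ofReal √(trajLikelihood M M' (D τ)) := fun D => by
      rw [Real.sqrt_prod _ fun _ _ => trajLikelihood_nonneg M M' _,
        ENNReal.ofReal_prod_of_nonneg fun _ _ => Real.sqrt_nonneg _]
    simp_rw [e]
    rw [dataLaw, lintegral_pi_prod (fun _ : Fin K => M.trajLaw ν π)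
      (f := fun _ x => ENNReal.ofReal √(trajLikelihood M M' x)) (fun _ => by fun_prop),
      Finset.prod_const, Finset.card_univ, Fintype.card_fin]
    -- the affinity of the product measures is a `K`-th power: Bernoulli's inequality
    have h1 : 1 - K * (B / 8) ≤ (1 - B / 8) ^ K := by
      have := one_add_mul_le_pow (a := -(B / 8)) (by linarith) K
      rw [← sub_eq_add_neg] at this
      linarith
    refine (ENNReal.ofReal_le_ofReal h1).trans ?_
    rw [ENNReal.ofReal_pow (by linarith)]
    refine pow_le_pow_left' ((ENNReal.ofReal_le_ofReal ?_).trans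
      (le_lintegral_sqrt_trajLikelihood M M' ν π)) K
    linarith

end TrajectoryLaw

end LinearDRMDP

/-! ### Numbers of visits -/

section VisitCounts

variable {S A : Type*} [DecidableEq S] [DecidableEq A] {H K : ℕ}

/-- The number of trajectories of the data set that are in the state `s` and take the action `a` at
step `h`. -/
def visitCount (D : Dataset S A H K) (h : Fin H) (s : S) (a : A) : ℕ :=
  (Finset.univ.filter fun τ => (D τ h).1 = s ∧ (D τ h).2.1 = a).card

lemma sum_eq_sum_visitCount [Fintype S] [Fintype A] (D : Dataset S A H K) (h : Fin H)
    (f : S → A → ℝ) :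
    ∑ τ, f (D τ h).1 (D τ h).2.1 = ∑ s, ∑ a, (visitCount D h s a : ℝ) * f s a := by
  have e : ∀ τ, f (D τ h).1 (D τ h).2.1
      = ∑ s, ∑ a, if (D τ h).1 = s ∧ (D τ h).2.1 = a then f s a else 0 := by
    intro τ
    simp [ite_and]
  simp_rw [e]
  rw [Finset.sum_comm]
  refine Finset.sum_congr rfl fun s _ => ?_
  rw [Finset.sum_comm]
  refine Finset.sum_congr rfl fun a _ => ?_
  rw [← Finset.sum_filter, Finset.sum_const, nsmul_eq_mul, visitCount]

variable [Fintype S] [Fintype A] [MeasurableSpace S] [MeasurableSpace A]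
  [DiscreteMeasurableSpace S] [DiscreteMeasurableSpace A] {n : ℕ} {φ : S → A → Distr (Fin n)}

/-- A Chernoff bound for the number of visits to a state-action pair, by exponential moments with
the base `1 / 2`. -/
lemma dataLaw_visitCount_lt_le (M : LinearDRMDP φ H) (ν : Distr S) (π : Policy S A) (h : Fin H)
    (s : S) (a : A) {p : ℝ}
    (hp : 0 ≤ p) (hpq : p ≤ expect π M.nominal 0 ν.1 h fun s' a' => if s' = s ∧ a' = a then 1 else 0) :
    M.dataLaw ν π K {D | (visitCount D h s a : ℝ) < K * p / 2}
      ≤ ENNReal.ofReal (Real.exp (-(K * p / 8))) := by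
  set g : S × A → ℝ := fun z => if z.1 = s ∧ z.2 = a then 1 / 2 else 1 with hg
  have hg0 : ∀ z, 0 < g z := fun z => by
    simp only [hg]; split_ifs <;> norm_num
  have hgm : Measurable fun x : Fin H → S × A × ℝ => ENNReal.ofReal (g ((x h).1, (x h).2.1)) :=
    (LinearDRMDP.measurable_of_finite_prod (f := fun y : S × A × ℝ =>
      ENNReal.ofReal (g (y.1, y.2.1))) fun s' a' =>
        (measurable_const : Measurable fun _ : ℝ => ENNReal.ofReal (g (s', a')))).comp (measurable_pi_apply h)
  have hint : ∫⁻ x, ENNReal.ofReal (g ((x h).1, (x h).2.1)) ∂M.trajLaw ν π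
      ≤ ENNReal.ofReal (Real.exp (-(p / 2))) := by
    rw [M.lintegral_trajLaw_path ν π (F := fun p => g (p h)) (fun p => (hg0 _).le) hgm]
    refine ENNReal.ofReal_le_ofReal ?_
    have e : ∀ z : S × A, g z = 1 - (if z.1 = s ∧ z.2 = a then 1 else 0) / 2 := fun z => by
      simp only [hg]; split_ifs <;> norm_num
    have e2 : ∑ q : Fin H → S × A, pathProb ν π M.nominal q * g (q h)
        = 1 - (expect π M.nominal 0 ν.1 h fun s' a' => if s' = s ∧ a' = a then 1 else 0) / 2 := by
      simp_rw [e, mul_sub, mul_one]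
      rw [Finset.sum_sub_distrib, sum_pathProb, ← sum_pathProb_mul, Finset.sum_div]
      simp_rw [mul_div_assoc]
    rw [e2]
    have := Real.add_one_le_exp (-(p / 2))
    linarith
  have hprod : ∫⁻ D, ∏ τ, ENNReal.ofReal (g ((D τ h).1, (D τ h).2.1)) ∂M.dataLaw ν π K
      ≤ ENNReal.ofReal (Real.exp (-(K * p / 2))) := by
    rw [LinearDRMDP.dataLaw, lintegral_pi_prod (fun _ : Fin K => M.trajLaw ν π)
      (f := fun _ x => ENNReal.ofReal (g ((x h).1, (x h).2.1))) (fun _ => hgm),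
      Finset.prod_const, Finset.card_univ, Fintype.card_fin]
    refine (pow_le_pow_left' hint K).trans ?_
    rw [← ENNReal.ofReal_pow (Real.exp_pos _).le, ← Real.exp_nat_mul]
    refine ENNReal.ofReal_le_ofReal (le_of_eq ?_)
    congr 1
    ring
  have hcount : ∀ D : Dataset S A H K, ∏ τ, ENNReal.ofReal (g ((D τ h).1, (D τ h).2.1))
      = ENNReal.ofReal (Real.exp (-(Real.log 2 * visitCount D h s a))) := by
    intro D
    rw [← ENNReal.ofReal_prod_of_nonneg fun τ _ => (hg0 _).le]
    congr 1
    simp only [hg]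
    rw [Finset.prod_ite, Finset.prod_const, Finset.prod_const_one, mul_one, ← visitCount,
      ← mul_neg_one, mul_right_comm, mul_neg_one, mul_comm, Real.exp_nat_mul, Real.exp_neg,
      Real.exp_log two_pos, one_div]
  set ε := ENNReal.ofReal (Real.exp (-(Real.log 2 * (K * p / 2)))) with hε
  have hsub : {D : Dataset S A H K | (visitCount D h s a : ℝ) < K * p / 2}
      ⊆ {D | ε ≤ ∏ τ, ENNReal.ofReal (g ((D τ h).1, (D τ h).2.1))} := by
    intro D hD
    rw [Set.mem_ofPred_eq] at hD
    rw [Set.mem_ofPred_eq, hcount, hε]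
    refine ENNReal.ofReal_le_ofReal (Real.exp_le_exp.2 (neg_le_neg ?_))
    exact mul_le_mul_of_nonneg_left hD.le (Real.log_pos one_lt_two).le
  have hmar := mul_meas_ge_le_lintegral (μ := M.dataLaw ν π K)
    (f := fun D => ∏ τ, ENNReal.ofReal (g ((D τ h).1, (D τ h).2.1)))
    (Finset.measurable_prod _ fun τ _ => hgm.comp (measurable_pi_apply τ)) ε
  have hε0 : ε ≠ 0 := by simp [hε, Real.exp_pos]
  have hεt : ε ≠ ∞ := ENNReal.ofReal_ne_top
  refine (measure_mono hsub).trans ?_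
  rw [← ENNReal.mul_le_mul_iff_right hε0 hεt]
  refine (hmar.trans hprod).trans ?_
  rw [hε, ← ENNReal.ofReal_mul (Real.exp_pos _).le, ← Real.exp_add]
  refine ENNReal.ofReal_le_ofReal (Real.exp_le_exp.2 ?_)
  have h2 := Real.log_two_lt_d9
  have hK : 0 ≤ K * p := by positivity
  nlinarith

end VisitCounts

/-! ### Features and covariance matrices -/

section Matrices

/-- With `y = B⁻¹ x` both `x ⬝ y` and `y ⬝ B y` equal `x ⬝ B⁻¹ x`, so that the hypothesis at this
`y` is the claim. -/
lemma dotProduct_inv_mulVec_le {n : ℕ} {B : Matrix (Fin n) (Fin n) ℝ} (hB : B.PosDef)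
    (x : Fin n → ℝ) {c : ℝ} (hc : 0 ≤ c) (h : ∀ y, (x ⬝ᵥ y) ^ 2 ≤ c * (y ⬝ᵥ B.mulVec y)) :
    x ⬝ᵥ B⁻¹.mulVec x ≤ c := by
  have hx : B.mulVec (B⁻¹.mulVec x) = x := by
    rw [Matrix.mulVec_mulVec, Matrix.mul_nonsing_inv _ ((Matrix.isUnit_iff_isUnit_det B).1 hB.isUnit),
      Matrix.one_mulVec]
  have h1 := h (B⁻¹.mulVec x)
  rw [hx, dotProduct_comm (B⁻¹.mulVec x) x] at h1
  by_contra hlt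
  push Not at hlt
  nlinarith

end Matrices

section HardFeatures

variable {d : ℕ}

/-- The actions of the behavior policy: `0` (for `none`) and the unit vectors `e_i`. -/
def probe (o : Option (Fin d)) : Fin d → Bool :=
  match o with
  | none => fun _ => false
  | some i => fun j => decide (j = i)

lemma probe_injective : Function.Injective (probe (d := d)) := by
  intro o o' h
  rcases o with _ | i <;> rcases o' with _ | j
  · rfl
  · simpa [probe] using congrFun h j
  · simpa [probe] using congrFun h i
  · simpa [probe] using congrFun h i

lemma sum_hardBehavior (h : ℕ) (s : Fin 2) (f : (Fin d → Bool) → ℝ) :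
    ∑ a, (hardBehavior d h s).1 a * f a = (∑ o, f (probe o)) / (d + 1) := by
  have e : ∀ a, (hardBehavior d h s).1 a
      = ∑ o : Option (Fin d), ((d : ℝ) + 1)⁻¹ * (if a = probe o then 1 else 0) := by
    intro a
    simp only [hardBehavior, mix, uniform, Fintype.card_option, Fintype.card_fin, Nat.cast_add,
      Nat.cast_one]
    refine Finset.sum_congr rfl fun o _ => ?_
    congr 1
    rcases o with _ | i <;> simp only [dirac, probe, Pi.single_apply] <;> congr
  simp_rw [e, Finset.sum_mul]
  rw [Finset.sum_comm, Finset.sum_div]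
  refine Finset.sum_congr rfl fun o _ => ?_
  simp only [mul_assoc, ← Finset.mul_sum, ite_mul, one_mul, zero_mul, Finset.sum_ite_eq',
    Finset.mem_univ, if_true]
  rw [inv_mul_eq_div]

lemma sum_option_probe_le (f : (Fin d → Bool) → ℝ) (hf : ∀ a, 0 ≤ f a) :
    ∑ o, f (probe o) ≤ ∑ a, f a := by
  rw [← Finset.sum_image (s := Finset.univ) (f := f) fun x _ y _ h => probe_injective h]
  exact Finset.sum_le_sum_of_subset_of_nonneg (Finset.subset_univ _) fun a _ _ => hf a

lemma hardFeature_zero_castSucc_castSucc (a : Fin d → Bool) (i : Fin d) :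
    (hardFeature d 0 a).1 i.castSucc.castSucc = (if a i then 1 else 0) / d := by
  simp [hardFeature]

lemma hardFeature_zero_castSucc_last (a : Fin d → Bool) :
    (hardFeature d 0 a).1 (Fin.last d).castSucc = 1 - ∑ i : Fin d, (if a i then (1 : ℝ) else 0) / d := by
  simp [hardFeature]

lemma hardFeature_zero_last (a : Fin d → Bool) :
    (hardFeature d 0 a).1 (Fin.last (d + 1)) = 0 := by
  simp [hardFeature]

lemma hardFeature_probe_some_dotProduct (hd : 1 ≤ d) (i : Fin d) (y : Fin (d + 2) → ℝ) :
    (d : ℝ) * ((hardFeature d 0 (probe (some i))).1 ⬝ᵥ y)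
      = y i.castSucc.castSucc + (d - 1) * y (Fin.last d).castSucc := by
  have hd0 : (d : ℝ) ≠ 0 := by positivity
  simp only [dotProduct, Fin.sum_univ_castSucc, hardFeature_zero_castSucc_castSucc,
    hardFeature_zero_castSucc_last, hardFeature_zero_last, probe]
  simp only [decide_eq_true_eq, ite_div, zero_div, ite_mul, zero_mul, Finset.sum_ite_eq',
    Finset.mem_univ, if_true]
  field_simp
  ring

lemma hardFeature_probe_none_dotProduct (y : Fin (d + 2) → ℝ) :
    (hardFeature d 0 (probe none)).1 ⬝ᵥ y = y (Fin.last d).castSucc := by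
  simp only [dotProduct, Fin.sum_univ_castSucc, hardFeature_zero_castSucc_castSucc,
    hardFeature_zero_castSucc_last, hardFeature_zero_last, probe]
  simp

/-- A quadratic quantity that dominates the squares of the products of `y` with the features of the
pairs `(x₁, e_i)`, `(x₁, 0)` (with weight `w`) and with the last unit vector (with weight `w'`)
controls all coordinates of `y`, because `𝟏_i = d φ(x₁, e_i) - (d - 1) φ(x₁, 0)`. -/
lemma sq_coord_le (hd : 1 ≤ d) {y : Fin (d + 2) → ℝ} {w w' Q : ℝ} (hw : 0 < w) (hw' : 0 < w')
    (hQ : w * ∑ o, ((hardFeature d 0 (probe o)).1 ⬝ᵥ y) ^ 2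
      + w' * (y (Fin.last (d + 1))) ^ 2 ≤ Q) (i : Fin (d + 2)) :
    y i ^ 2 ≤ max (2 * d ^ 2 / w) (1 / w') * Q := by
  have h0 : ∀ o, 0 ≤ ((hardFeature d 0 (probe o)).1 ⬝ᵥ y) ^ 2 := fun o => sq_nonneg _
  have hd1 : (1 : ℝ) ≤ d := by exact_mod_cast hd
  have hQ0 : 0 ≤ Q := le_trans (add_nonneg
    (mul_nonneg hw.le (Finset.sum_nonneg fun o _ => h0 o)) (by positivity)) hQ
  rw [Fintype.sum_option, hardFeature_probe_none_dotProduct] at hQ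
  have hs : ∀ i : Fin d, ((hardFeature d 0 (probe (some i))).1 ⬝ᵥ y) ^ 2
      ≤ ∑ i : Fin d, ((hardFeature d 0 (probe (some i))).1 ⬝ᵥ y) ^ 2 := fun i =>
    Finset.single_le_sum (f := fun i => ((hardFeature d 0 (probe (some i))).1 ⬝ᵥ y) ^ 2)
      (fun i _ => sq_nonneg _) (Finset.mem_univ i)
  have hs0 : 0 ≤ ∑ i : Fin d, ((hardFeature d 0 (probe (some i))).1 ⬝ᵥ y) ^ 2 :=
    Finset.sum_nonneg fun i _ => sq_nonneg _
  have hl0 := mul_nonneg hw'.le (sq_nonneg (y (Fin.last (d + 1))))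
  refine Fin.lastCases ?_ (fun i => Fin.lastCases ?_ (fun i => ?_) i) i
  · refine le_trans ?_ (mul_le_mul_of_nonneg_right (le_max_right _ _) hQ0)
    rw [one_div, inv_mul_eq_div, le_div_iff₀ hw']
    nlinarith [sq_nonneg (y (Fin.last d).castSucc)]
  · refine le_trans ?_ (mul_le_mul_of_nonneg_right (le_max_left _ _) hQ0)
    rw [div_mul_eq_mul_div, le_div_iff₀ hw]
    have : y (Fin.last d).castSucc ^ 2 * w ≤ Q := by nlinarith
    have hd2 : 1 ≤ 2 * (d : ℝ) ^ 2 := by nlinarith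
    nlinarith [mul_le_mul_of_nonneg_right hd2 hQ0]
  · refine le_trans ?_ (mul_le_mul_of_nonneg_right (le_max_left _ _) hQ0)
    rw [div_mul_eq_mul_div, le_div_iff₀ hw]
    have h1 := hardFeature_probe_some_dotProduct hd i y
    have h2 := hs i
    set u := (hardFeature d 0 (probe (some i))).1 ⬝ᵥ y
    set v := y (Fin.last d).castSucc
    have h3 : (v ^ 2 + u ^ 2) * w ≤ Q := by nlinarith
    have h4 : y i.castSucc.castSucc = d * u - (d - 1) * v := by linarith
    have h5 : y i.castSucc.castSucc ^ 2 ≤ 2 * d ^ 2 * (v ^ 2 + u ^ 2) := by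
      rw [h4]
      have h6 : (d * u - (d - 1) * v) ^ 2 ≤ 2 * ((d * u) ^ 2 + ((d - 1) * v) ^ 2) := by
        nlinarith [sq_nonneg (d * u + (d - 1) * v)]
      have h7 : ((d - 1) * v) ^ 2 ≤ (d * v) ^ 2 := by
        rw [mul_pow, mul_pow]
        gcongr
        linarith
      nlinarith
    nlinarith [mul_le_mul_of_nonneg_left h3 (by positivity : (0 : ℝ) ≤ 2 * d ^ 2)]

/-- A weighted sum of squares over all state-action pairs dominates its part over the pairs
`(x₁, e_i)`, `(x₁, 0)` and `(x₂, 0)`. -/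
lemma sum_mul_sq_feature_ge {φ : Fin 2 → (Fin d → Bool) → Distr (Fin (d + 2))}
    (h0 : ∀ a, φ 0 a = hardFeature d 0 a) (h1 : φ 1 (probe none) = dirac (Fin.last (d + 1)))
    {c : Fin 2 → (Fin d → Bool) → ℝ} (hc : ∀ s a, 0 ≤ c s a) {w w' : ℝ}
    (hw : ∀ o, w ≤ c 0 (probe o)) (hw' : w' ≤ c 1 (probe none)) (y : Fin (d + 2) → ℝ) :
    w * ∑ o, ((hardFeature d 0 (probe o)).1 ⬝ᵥ y) ^ 2 + w' * (y (Fin.last (d + 1))) ^ 2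
      ≤ ∑ s, ∑ a, c s a * ((φ s a).1 ⬝ᵥ y) ^ 2 := by
  rw [Fin.sum_univ_two]
  refine add_le_add ?_ ?_
  · rw [Finset.mul_sum]
    refine le_trans (Finset.sum_le_sum fun o _ =>
      mul_le_mul_of_nonneg_right (hw o) (sq_nonneg _)) ?_
    simp_rw [h0]
    exact sum_option_probe_le (fun a => c 0 a * ((hardFeature d 0 a).1 ⬝ᵥ y) ^ 2)
      fun a => mul_nonneg (hc 0 a) (sq_nonneg _)
  · refine le_trans ?_ (Finset.single_le_sum (f := fun a => c 1 a * ((φ 1 a).1 ⬝ᵥ y) ^ 2)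
      (fun a _ => mul_nonneg (hc 1 a) (sq_nonneg _)) (Finset.mem_univ (probe none)))
    simp only [h1, dirac, single_one_dotProduct]
    exact mul_le_mul_of_nonneg_right hw' (sq_nonneg _)

end HardFeatures

section Uncertainty

namespace LinearDRMDP

variable {S A : Type*} [Fintype S] [DecidableEq S] [Fintype A] {n H K : ℕ}
  {φ : S → A → Distr (Fin n)}

lemma dotProduct_vecMulVec_mulVec (v y : Fin n → ℝ) :
    y ⬝ᵥ (Matrix.vecMulVec v v).mulVec y = (v ⬝ᵥ y) ^ 2 := by
  rw [Matrix.vecMulVec_mulVec]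
  simp [dotProduct_comm y v, sq]

lemma weightedCov_eq (M : LinearDRMDP φ H) {ρ : ℕ → ℝ} {h : Fin H}
    (hM : ∀ s a, M.truncVar ρ h s a = 1) (lam : ℝ) (D : Dataset S A H K) :
    M.weightedCov ρ lam D h
      = ∑ τ, Matrix.vecMulVec (φ (D τ h).1 (D τ h).2.1).1 (φ (D τ h).1 (D τ h).2.1).1
        + lam • (1 : Matrix (Fin n) (Fin n) ℝ) := by
  simp [weightedCov, hM]

lemma dotProduct_weightedCov_mulVec (M : LinearDRMDP φ H) {ρ : ℕ → ℝ} {h : Fin H}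
    (hM : ∀ s a, M.truncVar ρ h s a = 1) (lam : ℝ) (D : Dataset S A H K) (y : Fin n → ℝ) :
    y ⬝ᵥ (M.weightedCov ρ lam D h).mulVec y
      = ∑ τ, ((φ (D τ h).1 (D τ h).2.1).1 ⬝ᵥ y) ^ 2 + lam * (y ⬝ᵥ y) := by
  rw [weightedCov_eq M hM, Matrix.add_mulVec, dotProduct_add, Matrix.sum_mulVec,
    dotProduct_sum, Matrix.smul_mulVec, Matrix.one_mulVec, dotProduct_smul, smul_eq_mul]
  simp_rw [dotProduct_vecMulVec_mulVec]

lemma posDef_weightedCov (M : LinearDRMDP φ H) {ρ : ℕ → ℝ} {h : Fin H}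
    (hM : ∀ s a, M.truncVar ρ h s a = 1) {lam : ℝ} (hlam : 0 < lam) (D : Dataset S A H K) :
    (M.weightedCov ρ lam D h).PosDef := by
  rw [weightedCov_eq M hM]
  refine Matrix.PosDef.posSemidef_add (Matrix.posSemidef_sum _ fun τ _ => ?_)
    (Matrix.PosDef.one.smul hlam)
  simpa using Matrix.posSemidef_vecMulVec_self_star (φ (D τ h).1 (D τ h).2.1).1

lemma matNorm_single_le {B : Matrix (Fin n) (Fin n) ℝ} {i : Fin n} {x b : ℝ} (hx : 0 ≤ x)
    (hb : 0 ≤ b) (hB : Pi.single i 1 ⬝ᵥ B.mulVec (Pi.single i 1) ≤ b ^ 2) :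
    matNorm B (Pi.single i x) ≤ x * b := by
  have e : (Pi.single i x : Fin n → ℝ) = x • Pi.single i 1 := by
    rw [← Pi.single_smul, smul_eq_mul, mul_one]
  rw [matNorm, e, Matrix.mulVec_smul, dotProduct_smul, smul_dotProduct, smul_eq_mul, smul_eq_mul]
  refine Real.sqrt_le_iff.2 ⟨by positivity, ?_⟩
  nlinarith [mul_le_mul_of_nonneg_left hB (sq_nonneg x)]

/-- A bound on the diagonal entries of all `(Σ_h^⋆)⁻¹` bounds the uncertainty function, because the
features are nonnegative with sum one. -/
lemma uncertainty_le (M : LinearDRMDP φ H) (ρ : ℕ → ℝ) (lam : ℝ) (D : Dataset S A H K)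
    (π : Policy S A) (s : S) {b : ℝ} (hb : 0 ≤ b)
    (hB : ∀ h i, Pi.single i 1 ⬝ᵥ (M.weightedCov ρ lam D h)⁻¹.mulVec (Pi.single i 1) ≤ b ^ 2) :
    M.uncertainty ρ lam D π s ≤ H * b := by
  refine Real.iSup_le (fun P => ?_) (by positivity)
  calc _ ≤ ∑ _h : Fin H, b := Finset.sum_le_sum fun h _ =>
        expect_le π P.1 0 (dirac s) h fun s' a => ?_
    _ = H * b := by simp
  calc _ ≤ ∑ i, (φ s' a).1 i * b := Finset.sum_le_sum fun i _ =>
        matNorm_single_le ((φ s' a).2.1 i) hb (hB h i)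
    _ = b := Distr.sum_mul_const _ _

end LinearDRMDP

end Uncertainty

/-! ### Sign families -/

lemma value_nonneg {S A : Type*} [Fintype S] [DecidableEq S] [Fintype A] {H : ℕ}
    {r : ℕ → S → A → ℝ} (hr : ∀ h < H, ∀ s a, 0 ≤ r h s a) (π : Policy S A) (P : Transition S A)
    (h : ℕ) (s : S) : 0 ≤ value H r π P h s := by
  refine Finset.sum_nonneg fun k hk => Finset.sum_nonneg fun s' _ => Finset.sum_nonneg fun a _ => ?_
  have hk' := Finset.mem_range.1 hk
  exact mul_nonneg (mul_nonneg ((stateLaw_mem π P h (dirac s) k).1 s') ((π _ _).2.1 a))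
    (hr _ (by omega) s' a)

/-- Backward induction on the steps. -/
lemma step_induction {p : ℕ → Prop} (H : ℕ) (h0 : ∀ h, H ≤ h → p h)
    (h1 : ∀ h < H, p (h + 1) → p h) (h : ℕ) : p h := by
  rcases le_total H h with hh | hh
  · exact h0 h hh
  · exact Nat.decreasingInduction' (fun k hk _ => h1 k hk) hh (h0 H le_rfl)

section SignVectors

variable {d : ℕ}

/-- The reward of the action `a` for the sign vector `b`, on the scale `η` and in a state in which
rewards are collected: `η (1/2 + ∑ᵢ aᵢ bᵢ / (2d))`. -/
def signReward (η : ℝ) (b a : Fin d → Bool) : ℝ :=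
  η * (1 / 2 + ∑ i, (if a i then (if b i then (1 : ℝ) else -1) else 0) / (2 * d))

/-- The loss of the action `a` against the best action for the sign vector `b`: it is proportional
to the Hamming distance of `a` and `b`. -/
def signLoss (η : ℝ) (b a : Fin d → Bool) : ℝ :=
  ∑ i, η / (2 * d) * if a i = b i then 0 else 1

lemma signReward_self_sub (η : ℝ) (b a : Fin d → Bool) :
    signReward η b b - signReward η b a = signLoss η b a := by
  simp only [signReward, signLoss]
  rw [← mul_sub, add_sub_add_left_eq_sub, ← Finset.sum_sub_distrib, Finset.mul_sum]
  refine Finset.sum_congr rfl fun i _ => ?_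
  cases a i <;> cases b i <;> simp <;> ring

lemma signLoss_nonneg {η : ℝ} (hη : 0 ≤ η) (b a : Fin d → Bool) : 0 ≤ signLoss η b a :=
  Finset.sum_nonneg fun i _ => mul_nonneg (by positivity) (by split_ifs <;> norm_num)

end SignVectors

/-- The total reward collected from step `h` on in `n` steps with the rewards `R`, when a fraction
`γ_t` of the collected reward survives the step `t`. -/
def discountedSum (R γ : ℕ → ℝ) : ℕ → ℕ → ℝ
  | 0, _ => 0
  | n + 1, h => R h + γ h * discountedSum R γ n (h + 1)

/-- A family of models, indexed by sign vectors, for which the robust control problem decouples.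
The reward in the state `s` is `u s` times a reward that depends on the action only, all members have
the same nominal kernels and the initial distribution `hardInit` is stationary for them under the
behavior policy. The transition kernels `W` belong to all uncertainty sets, have `u` as an
eigenfunction with the eigenvalue `γ_h`, and no kernel in the uncertainty sets is worse for `u`; under
the nominal kernels `u` has variance zero. The two conditions on `φ` fix the features of the pairs from
which all coordinates can be recovered. -/
structure IsSignFamily {d H : ℕ} {φ : Fin 2 → (Fin d → Bool) → Distr (Fin (d + 2))} (η : ℝ)
    (ρ γ : ℕ → ℝ) (u : Fin 2 → ℝ) (W : Transition (Fin 2) (Fin d → Bool))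
    (M : (ℕ → Fin d → Bool) → LinearDRMDP φ H) : Prop where
  scale_nonneg : 0 ≤ η
  feature_zero : ∀ a, φ 0 a = hardFeature d 0 a
  feature_one : φ 1 (probe none) = dirac (Fin.last (d + 1))
  nominal_eq : ∀ ξ ξ', (M ξ).nominal = (M ξ').nominal
  stationary : ∀ ξ h s', ∑ s, ∑ a, (hardInit d).1 s * (hardBehavior d h s).1 a
    * ((M ξ).nominal h s a).1 s' = (hardInit d).1 s'
  reward_eq : ∀ ξ h s a, (M ξ).reward h s a = u s * signReward η (ξ h) a
  weight_mem : ∀ s, u s ∈ Set.Icc (0 : ℝ) 1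
  variance_weight : ∀ ξ h s a, ∑ s', ((M ξ).nominal h s a).1 s' * u s' ^ 2
    = (∑ s', ((M ξ).nominal h s a).1 s' * u s') ^ 2
  factor_nonneg : ∀ h, 0 ≤ γ h
  worst_mem : ∀ ξ, W ∈ (M ξ).uncertaintySet ρ
  worst_eq : ∀ h s a, ∑ s', (W h s a).1 s' * u s' = γ h * u s
  le_of_mem : ∀ ξ, ∀ P ∈ (M ξ).uncertaintySet ρ, ∀ h s a, γ h * u s ≤ ∑ s', (P h s a).1 s' * u s'

namespace IsSignFamily

variable {d H : ℕ} {φ : Fin 2 → (Fin d → Bool) → Distr (Fin (d + 2))} {η : ℝ}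
  {ρ γ : ℕ → ℝ} {u : Fin 2 → ℝ} {W : Transition (Fin 2) (Fin d → Bool)}
  {M : (ℕ → Fin d → Bool) → LinearDRMDP φ H}

/-! ### Robust values -/

/-- The policy that plays the sign vector. -/
def greedy (ξ : ℕ → Fin d → Bool) : Policy (Fin 2) (Fin d → Bool) := fun h _ => dirac (ξ h)

lemma sum_greedy (ξ : ℕ → Fin d → Bool) (h : ℕ) (s : Fin 2) (f : (Fin d → Bool) → ℝ) :
    ∑ a, (greedy ξ h s).1 a * f a = f (ξ h) := by
  simp only [greedy, dirac]
  rw [Finset.sum_eq_single (ξ h)]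
  · simp
  · intro b _ hb
    simp [Pi.single_eq_of_ne hb]
  · simp

/-- The optimal robust value at step `h` is `u s` times this quantity. -/
def optScale (H : ℕ) (η : ℝ) (γ : ℕ → ℝ) (ξ : ℕ → Fin d → Bool) (h : ℕ) : ℝ :=
  discountedSum (fun t => signReward η (ξ t) (ξ t)) γ (H - h) h

lemma optScale_of_le (ξ : ℕ → Fin d → Bool) {h : ℕ} (hh : H ≤ h) : optScale H η γ ξ h = 0 := by
  rw [optScale, Nat.sub_eq_zero_of_le hh, discountedSum]

lemma optScale_eq (ξ : ℕ → Fin d → Bool) {h : ℕ} (hh : h < H) :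
    optScale H η γ ξ h = signReward η (ξ h) (ξ h) + γ h * optScale H η γ ξ (h + 1) := by
  rw [optScale, show H - h = (H - (h + 1)) + 1 by omega, discountedSum, optScale]

lemma signReward_self_nonneg (hη : 0 ≤ η) (b : Fin d → Bool) : 0 ≤ signReward η b b := by
  refine mul_nonneg hη (add_nonneg (by norm_num) (Finset.sum_nonneg fun i _ => ?_))
  cases b i <;> simp

lemma optScale_nonneg (hM : IsSignFamily η ρ γ u W M) (ξ : ℕ → Fin d → Bool) (h : ℕ) :
    0 ≤ optScale H η γ ξ h := by
  simp only [optScale]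
  generalize H - h = n
  induction n generalizing h with
  | zero => exact le_rfl
  | succ n ih =>
    exact add_nonneg (signReward_self_nonneg hM.scale_nonneg _)
      (mul_nonneg (hM.factor_nonneg h) (ih _))

/-- Under the worst kernels the value of a policy falls short of the optimum by the expected loss. -/
lemma sub_value_worst (hM : IsSignFamily η ρ γ u W M) (ξ : ℕ → Fin d → Bool)
    (π : Policy (Fin 2) (Fin d → Bool)) (h : ℕ) :
    ∀ s, u s * optScale H η γ ξ h - value H (M ξ).reward π W h s
      = value H (fun t s a => u s * signLoss η (ξ t) a) π W h s := by
  refine step_induction (p := fun h => ∀ s, u s * optScale H η γ ξ h - value H (M ξ).reward π W h s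
      = value H (fun t s a => u s * signLoss η (ξ t) a) π W h s) H (fun h hh s => ?_)
    (fun h hh ih s => ?_) h
  · rw [value_of_le _ _ _ hh, value_of_le _ _ _ hh, optScale_of_le ξ hh, mul_zero, sub_zero]
  · rw [value_eq _ _ _ hh, value_eq _ _ _ hh, ← (π h s).sum_mul_const (u s * _),
      ← Finset.sum_sub_distrib]
    refine Finset.sum_congr rfl fun a _ => ?_
    rw [← mul_sub]
    congr 1
    simp_rw [← ih, mul_sub, Finset.sum_sub_distrib, ← mul_assoc, ← Finset.sum_mul]
    rw [hM.worst_eq, optScale_eq ξ hh, hM.reward_eq, ← signReward_self_sub]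
    ring

lemma value_worst_le (hM : IsSignFamily η ρ γ u W M) (ξ : ℕ → Fin d → Bool)
    (π : Policy (Fin 2) (Fin d → Bool)) (h : ℕ) (s : Fin 2) :
    value H (M ξ).reward π W h s ≤ u s * optScale H η γ ξ h := by
  have h1 := hM.sub_value_worst ξ π h s
  have h2 := value_nonneg (H := H) (r := fun t s a => u s * signLoss η (ξ t) a)
    (fun t _ s a => mul_nonneg (hM.weight_mem s).1 (signLoss_nonneg hM.scale_nonneg _ _)) π W h s
  linarith

/-- Playing the sign vector guarantees the optimum against all kernels of the uncertainty set: the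
continuation value is a nonnegative multiple of `u`, for which no kernel is worse than `W`. -/
lemma le_value_greedy (hM : IsSignFamily η ρ γ u W M) (ξ : ℕ → Fin d → Bool)
    {P : Transition (Fin 2) (Fin d → Bool)} (hP : P ∈ (M ξ).uncertaintySet ρ) (h : ℕ) :
    ∀ s, u s * optScale H η γ ξ h ≤ value H (M ξ).reward (greedy ξ) P h s := by
  refine step_induction (p := fun h => ∀ s,
    u s * optScale H η γ ξ h ≤ value H (M ξ).reward (greedy ξ) P h s) H (fun h hh s => ?_)
    (fun h hh ih s => ?_) h
  · rw [value_of_le _ _ _ hh, optScale_of_le ξ hh, mul_zero]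
  · rw [value_eq _ _ _ hh, sum_greedy, optScale_eq ξ hh, hM.reward_eq, mul_add]
    refine add_le_add le_rfl ?_
    calc u s * (γ h * optScale H η γ ξ (h + 1)) = γ h * u s * optScale H η γ ξ (h + 1) := by ring
      _ ≤ (∑ s', (P h s (ξ h)).1 s' * u s') * optScale H η γ ξ (h + 1) :=
          mul_le_mul_of_nonneg_right (hM.le_of_mem ξ P hP h s _) (hM.optScale_nonneg ξ _)
      _ ≤ _ := by
          rw [Finset.sum_mul]
          refine Finset.sum_le_sum fun s' _ => ?_
          rw [mul_assoc]
          exact mul_le_mul_of_nonneg_left (ih s') ((P h s _).2.1 s')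

lemma bddBelow_value (N : LinearDRMDP φ H) (π : Policy (Fin 2) (Fin d → Bool)) (h : ℕ) (s : Fin 2) :
    BddBelow (Set.range fun P : N.uncertaintySet ρ => value H N.reward π P.1 h s) :=
  ⟨0, by
    rintro _ ⟨P, rfl⟩
    exact value_nonneg (fun h hh s a => (N.reward_mem h hh s a).1) π P.1 h s⟩

lemma robustValue_le_value_worst (hM : IsSignFamily η ρ γ u W M) (ξ : ℕ → Fin d → Bool)
    (π : Policy (Fin 2) (Fin d → Bool)) (h : ℕ) (s : Fin 2) :
    (M ξ).robustValue ρ π h s ≤ value H (M ξ).reward π W h s :=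
  ciInf_le (bddBelow_value (M ξ) π h s) ⟨W, hM.worst_mem ξ⟩

lemma robustValue_le (hM : IsSignFamily η ρ γ u W M) (ξ : ℕ → Fin d → Bool)
    (π : Policy (Fin 2) (Fin d → Bool)) (h : ℕ) (s : Fin 2) :
    (M ξ).robustValue ρ π h s ≤ u s * optScale H η γ ξ h :=
  (hM.robustValue_le_value_worst ξ π h s).trans (hM.value_worst_le ξ π h s)

lemma robustValue_greedy (hM : IsSignFamily η ρ γ u W M) (ξ : ℕ → Fin d → Bool) (h : ℕ)
    (s : Fin 2) : (M ξ).robustValue ρ (greedy ξ) h s = u s * optScale H η γ ξ h := by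
  refine le_antisymm (hM.robustValue_le ξ _ h s) ?_
  have : Nonempty ((M ξ).uncertaintySet ρ) := ⟨⟨W, hM.worst_mem ξ⟩⟩
  exact le_ciInf fun P => hM.le_value_greedy ξ P.2 h s

lemma optValue_eq (hM : IsSignFamily η ρ γ u W M) (ξ : ℕ → Fin d → Bool) (h : ℕ) (s : Fin 2) :
    (M ξ).optValue ρ h s = u s * optScale H η γ ξ h := by
  have : Nonempty (Policy (Fin 2) (Fin d → Bool)) := ⟨greedy ξ⟩
  refine le_antisymm (ciSup_le fun π => hM.robustValue_le ξ π h s) ?_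
  rw [← hM.robustValue_greedy ξ h s]
  exact le_ciSup (f := fun π => (M ξ).robustValue ρ π h s)
    ⟨_, by rintro _ ⟨π, rfl⟩; exact hM.robustValue_le ξ π h s⟩ (greedy ξ)

lemma isOptimal_greedy (hM : IsSignFamily η ρ γ u W M) (ξ : ℕ → Fin d → Bool) :
    (M ξ).IsOptimal ρ (greedy ξ) := fun h _ s => by
  rw [hM.robustValue_greedy, hM.optValue_eq]

/-- The optimal value is a multiple of `u`, which has variance zero under the nominal kernels. -/
lemma truncVar_eq_one (hM : IsSignFamily η ρ γ u W M) (ξ : ℕ → Fin d → Bool) (h : ℕ)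
    (s : Fin 2) (a : Fin d → Bool) : (M ξ).truncVar ρ h s a = 1 := by
  simp only [LinearDRMDP.truncVar, hM.optValue_eq, mul_pow, ← mul_assoc]
  rw [← Finset.sum_mul, ← Finset.sum_mul, hM.variance_weight, mul_pow, sub_self]
  exact max_eq_left zero_le_one

lemma le_subOpt (hM : IsSignFamily η ρ γ u W M) (ξ : ℕ → Fin d → Bool)
    (π : Policy (Fin 2) (Fin d → Bool)) (s : Fin 2) :
    value H (fun t s a => u s * signLoss η (ξ t) a) π W 0 s ≤ (M ξ).subOpt ρ π s := by
  rw [LinearDRMDP.subOpt, hM.optValue_eq, ← hM.sub_value_worst]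
  linarith [hM.robustValue_le_value_worst ξ π 0 s]

end IsSignFamily

/-! ### The minimax risk of a sign family -/

/-- Assouad's lemma, in the form of an averaging over all vertices of the hypercube. -/
lemma assouad {J : Type*} [Fintype J] [DecidableEq J] {R ε : ℝ≥0∞} (G : (J → Bool) → J → ℝ≥0∞)
    (hR : ∀ β, ∑ j, G β j ≤ R)
    (hε : ∀ β j, ε ≤ G β j + G (Function.update β j (!β j)) j) :
    Fintype.card J * ε ≤ 2 * R := by
  have hflip : ∀ j, ∑ β, G (Function.update β j (!β j)) j = ∑ β, G β j := by
    intro j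
    have hinv : Function.Involutive fun β : J → Bool => Function.update β j (!β j) := by
      intro β
      simp
    exact Equiv.sum_comp hinv.toPerm fun β => G β j
  have h1 : ∀ j, (Fintype.card (J → Bool) : ℝ≥0∞) * ε ≤ 2 * ∑ β, G β j := by
    intro j
    rw [two_mul]
    nth_rewrite 2 [← hflip j]
    rw [← Finset.sum_add_distrib, ← nsmul_eq_mul, ← Finset.card_univ]
    exact Finset.card_nsmul_le_sum _ _ _ fun β _ => hε β j
  have h2 : ∑ β, ∑ j, G β j ≤ (Fintype.card (J → Bool) : ℝ≥0∞) * R := by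
    rw [← nsmul_eq_mul, ← Finset.card_univ]
    exact Finset.sum_le_card_nsmul _ _ _ fun β _ => hR β
  have h3 : (Fintype.card (J → Bool) : ℝ≥0∞) * (Fintype.card J * ε)
      ≤ (Fintype.card (J → Bool) : ℝ≥0∞) * (2 * R) := by
    calc (Fintype.card (J → Bool) : ℝ≥0∞) * (Fintype.card J * ε)
        = ∑ _j : J, (Fintype.card (J → Bool) : ℝ≥0∞) * ε := by
          rw [Finset.sum_const, nsmul_eq_mul, Finset.card_univ]; ring
      _ ≤ ∑ j, 2 * ∑ β, G β j := Finset.sum_le_sum fun j _ => h1 j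
      _ = 2 * ∑ β, ∑ j, G β j := by rw [← Finset.mul_sum, Finset.sum_comm]
      _ ≤ 2 * ((Fintype.card (J → Bool) : ℝ≥0∞) * R) := mul_le_mul_right h2 _
      _ = _ := by ring
  rwa [ENNReal.mul_le_mul_iff_right (by simp) (by simp)] at h3

section Measurability

variable {S A : Type*} [Fintype A]

lemma measurable_policy_apply (h : ℕ) (s : S) (a : A) :
    Measurable fun π : Policy S A => (π h s).1 a :=
  (measurable_pi_apply a).comp (measurable_subtype_coe.comp
    ((measurable_pi_apply s).comp (measurable_pi_apply h)))

lemma measurable_stateLaw [Fintype S] (P : Transition S A) (h : ℕ) (ν : S → ℝ) (k : ℕ) (s : S) :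
    Measurable fun π : Policy S A => stateLaw π P h ν k s := by
  induction k generalizing s with
  | zero => exact measurable_const
  | succ k ih =>
    simp only [stateLaw]
    exact Finset.measurable_sum _ fun s' _ => Finset.measurable_sum _ fun a _ =>
      ((ih s').mul (measurable_policy_apply _ _ _)).mul_const _

end Measurability

/-- The probability under `π` and `P`, started in `s`, that the action at step `h` differs from `b`
in the coordinate `i`, weighted with `u` of the state at that step. -/
def missWeight {d : ℕ} (u : Fin 2 → ℝ) (P : Transition (Fin 2) (Fin d → Bool)) (s : Fin 2) (h : ℕ)
    (i : Fin d) (b : Bool) (π : Policy (Fin 2) (Fin d → Bool)) : ℝ :=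
  expect π P 0 (Pi.single s 1) h fun s' a => u s' * if a i = b then 0 else 1

section MissWeight

variable {d : ℕ} {u : Fin 2 → ℝ} {P : Transition (Fin 2) (Fin d → Bool)} {s : Fin 2} {h : ℕ}
  {i : Fin d}

lemma measurable_missWeight (b : Bool) : Measurable (missWeight u P s h i b) := by
  unfold missWeight expect
  exact Finset.measurable_sum _ fun s' _ => Finset.measurable_sum _ fun a _ =>
    ((measurable_stateLaw P 0 _ h s').mul (measurable_policy_apply _ _ _)).mul_const _

lemma missWeight_nonneg (hu : ∀ s, 0 ≤ u s) (b : Bool) (π : Policy (Fin 2) (Fin d → Bool)) :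
    0 ≤ missWeight u P s h i b π := by
  unfold missWeight expect
  refine Finset.sum_nonneg fun s' _ => Finset.sum_nonneg fun a _ => mul_nonneg
    (mul_nonneg ((stateLaw_mem π P 0 (dirac s) h).1 s') ((π _ _).2.1 a)) (mul_nonneg (hu s') ?_)
  split_ifs <;> norm_num

lemma missWeight_add_not (b : Bool) (π : Policy (Fin 2) (Fin d → Bool)) :
    missWeight u P s h i b π + missWeight u P s h i (!b) π
      = ∑ s', stateLaw π P 0 (Pi.single s 1) h s' * u s' := by
  simp only [missWeight, expect]
  rw [← Finset.sum_add_distrib]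
  refine Finset.sum_congr rfl fun s' _ => ?_
  rw [← Finset.sum_add_distrib, ← (π (0 + h) s').sum_mul_const (_ * u s')]
  refine Finset.sum_congr rfl fun a _ => ?_
  cases a i <;> cases b <;> simp <;> ring

lemma value_signLoss_eq {H : ℕ} (η : ℝ) (ξ : ℕ → Fin d → Bool)
    (π : Policy (Fin 2) (Fin d → Bool)) :
    value H (fun t s a => u s * signLoss η (ξ t) a) π P 0 s
      = ∑ j : Fin H × Fin d, η / (2 * d) * missWeight u P s j.1 j.2 (ξ j.1 j.2) π := by
  rw [value, Nat.sub_zero, Fintype.sum_prod_type, Finset.sum_range]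
  refine Finset.sum_congr rfl fun h _ => ?_
  simp only [missWeight, expect, signLoss, Finset.mul_sum, zero_add]
  symm
  rw [Finset.sum_comm]
  refine Finset.sum_congr rfl fun s' _ => ?_
  rw [Finset.sum_comm]
  refine Finset.sum_congr rfl fun a _ => Finset.sum_congr rfl fun i _ => ?_
  ring

end MissWeight

namespace IsSignFamily

variable {d H K : ℕ} {φ : Fin 2 → (Fin d → Bool) → Distr (Fin (d + 2))} {η : ℝ}
  {ρ γ : ℕ → ℝ} {u : Fin 2 → ℝ} {W : Transition (Fin 2) (Fin d → Bool)}
  {M : (ℕ → Fin d → Bool) → LinearDRMDP φ H}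

/-- The expectation of `u` under the worst kernels does not depend on the policy. -/
lemma sum_stateLaw_worst (hM : IsSignFamily η ρ γ u W M) (π : Policy (Fin 2) (Fin d → Bool))
    (s : Fin 2) (k : ℕ) :
    ∑ s', stateLaw π W 0 (Pi.single s 1) k s' * u s' = (∏ t ∈ Finset.range k, γ t) * u s := by
  induction k with
  | zero => simp [stateLaw, Pi.single_apply]
  | succ k ih =>
    rw [Finset.prod_range_succ, mul_right_comm, ← ih, Finset.sum_mul]
    simp only [stateLaw, zero_add, Finset.sum_mul]
    rw [Finset.sum_comm]
    refine Finset.sum_congr rfl fun s' _ => ?_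
    rw [Finset.sum_comm, ← (π k s').sum_mul_const (_ * u s' * γ k)]
    refine Finset.sum_congr rfl fun a _ => ?_
    simp_rw [mul_assoc, ← Finset.mul_sum, hM.worst_eq]
    ring

/-! ### The behavior policy -/

lemma stateLaw_hardBehavior (hM : IsSignFamily η ρ γ u W M) (ξ : ℕ → Fin d → Bool) (k : ℕ) :
    stateLaw (hardBehavior d) (M ξ).nominal 0 (hardInit d).1 k = (hardInit d).1 := by
  induction k with
  | zero => rfl
  | succ k ih =>
    funext s'
    simp only [stateLaw, zero_add, ih]
    exact hM.stationary ξ k s'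

lemma expect_hardBehavior (hM : IsSignFamily η ρ γ u W M) (ξ : ℕ → Fin d → Bool) (k : ℕ)
    (f : Fin 2 → (Fin d → Bool) → ℝ) :
    expect (hardBehavior d) (M ξ).nominal 0 (hardInit d).1 k f
      = ∑ s, (hardInit d).1 s * ((∑ o, f s (probe o)) / (d + 1)) := by
  simp only [expect, hM.stateLaw_hardBehavior, mul_assoc, ← Finset.mul_sum, sum_hardBehavior]

lemma sum_probe_apply (i : Fin d) :
    ∑ o : Option (Fin d), (if probe o i then (1 : ℝ) else 0) = 1 := by
  rw [Fintype.sum_option]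
  simp [probe]

/-- Two sign vectors that agree away from `i` differ in reward only if the action uses `i`, and then by
at most `η / d`. -/
lemma signReward_sub_sq_le {b b' : Fin d → Bool} {i : Fin d}
    (hb : ∀ j ≠ i, b' j = b j) (a : Fin d → Bool) :
    (signReward η b' a - signReward η b a) ^ 2 ≤ (η / d) ^ 2 * if a i then 1 else 0 := by
  have e : signReward η b' a - signReward η b a
      = η * (((if a i then (if b' i then (1 : ℝ) else -1) else 0)
        - (if a i then (if b i then (1 : ℝ) else -1) else 0)) / (2 * d)) := by
    simp only [signReward]
    rw [← mul_sub, add_sub_add_left_eq_sub, ← Finset.sum_sub_distrib,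
      Finset.sum_eq_single i]
    · rw [sub_div]
    · intro j _ hj
      rw [hb j hj, sub_self]
    · simp
  have hd : (0 : ℝ) < d := by exact_mod_cast i.pos
  have h0 : 0 ≤ (η / d) ^ 2 := sq_nonneg _
  rw [e]
  cases a i <;> cases b i <;> cases b' i <;> simp <;> first | positivity | skip
  all_goals apply le_of_eq; field_simp; ring

/-- The two-point bound for a flip of the bit `(h, i)`. Only the trajectories that play `e_i` at step
`h`, a fraction of at most `1 / (d + 1)`, are informative, and the means of their rewards differ by
`η / d`. At the scale `η ^ 2 = d ^ 3 / (2 K)` the data sets do not reveal the bit. -/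
lemma two_point (hM : IsSignFamily η ρ γ u W M) (hη : K * η ^ 2 ≤ d ^ 3 / 2) (hK : 1 ≤ K)
    (hγ : ∀ h, 1 / 4 ≤ ∏ t ∈ Finset.range h, γ t) {s : Fin 2} (hs : u s = 1)
    {πhat : Dataset (Fin 2) (Fin d → Bool) H K → Policy (Fin 2) (Fin d → Bool)}
    (hπ : Measurable πhat) {h : ℕ} {i : Fin d} {ξ ξ' : ℕ → Fin d → Bool}
    (h1 : ∀ t ≠ h, ξ' t = ξ t) (h2 : ∀ j ≠ i, ξ' h j = ξ h j) (h3 : ξ' h i = !ξ h i) :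
    ENNReal.ofReal (7 / 64)
      ≤ ∫⁻ D, ENNReal.ofReal (missWeight u W s h i (ξ h i) (πhat D))
          ∂(M ξ).dataLaw (hardInit d) (hardBehavior d) K
        + ∫⁻ D, ENNReal.ofReal (missWeight u W s h i (ξ' h i) (πhat D))
          ∂(M ξ').dataLaw (hardInit d) (hardBehavior d) K := by
  have hd : (1 : ℝ) ≤ d := by exact_mod_cast i.pos
  have hK1 : (1 : ℝ) ≤ K := by exact_mod_cast hK
  have hB : (∑ t : Fin H, expect (hardBehavior d) (M ξ).nominal 0 (hardInit d).1 t fun s a =>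
      ((M ξ').reward t s a - (M ξ).reward t s a) ^ 2) ≤ (η / d) ^ 2 / (d + 1) := by
    have hterm : ∀ t : Fin H, (expect (hardBehavior d) (M ξ).nominal 0 (hardInit d).1 t fun s a =>
      ((M ξ').reward t s a - (M ξ).reward t s a) ^ 2)
        ≤ if t.1 = h then (η / d) ^ 2 / (d + 1) else 0 := by
      intro t
      rw [hM.expect_hardBehavior]
      simp only [hM.reward_eq, ← mul_sub, mul_pow]
      split_ifs with ht
      · refine Distr.sum_mul_le (hardInit d) fun s' => ?_
        gcongr
        calc ∑ o, u s' ^ 2 * (signReward η (ξ' t) (probe o) - signReward η (ξ t) (probe o)) ^ 2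
            ≤ ∑ o, (η / d) ^ 2 * if probe o i then 1 else 0 := by
              refine Finset.sum_le_sum fun o _ => ?_
              have hu := hM.weight_mem s'
              have hu2 : u s' ^ 2 ≤ 1 := pow_le_one₀ hu.1 hu.2
              refine le_trans (mul_le_of_le_one_left (sq_nonneg _) hu2) ?_
              rw [ht]
              exact signReward_sub_sq_le h2 _
          _ = (η / d) ^ 2 := by rw [← Finset.mul_sum, sum_probe_apply, mul_one]
      · rw [h1 t ht]
        simp
    refine (Finset.sum_le_sum fun t _ => hterm t).trans ?_
    by_cases hh : h < H
    · rw [Finset.sum_eq_single (⟨h, hh⟩ : Fin H)]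
      · simp
      · intro t _ ht
        rw [if_neg fun e => ht (Fin.ext e)]
      · simp
    · rw [Finset.sum_eq_zero fun t _ => if_neg (by have := t.2; omega)]
      positivity
  have hKB : K * ((η / d) ^ 2 / (d + 1)) ≤ 1 / 2 := by
    rw [div_pow, div_div, mul_div_assoc', div_le_iff₀ (by positivity)]
    nlinarith [sq_nonneg (d : ℝ)]
  have hBle : (η / d) ^ 2 / (d + 1) ≤ 8 := by
    have h0 : 0 ≤ (η / d) ^ 2 / (d + 1) := by positivity
    nlinarith
  have hmain := LinearDRMDP.two_point_bound_dataLaw (hM.nominal_eq ξ' ξ) (hardInit d) (hardBehavior d)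
    (K := K) (f := fun D => missWeight u W s h i (ξ h i) (πhat D))
    (g := fun D => missWeight u W s h i (ξ' h i) (πhat D))
    ((measurable_missWeight _).comp hπ) ((measurable_missWeight _).comp hπ)
    (fun D => missWeight_nonneg (fun s => (hM.weight_mem s).1) _ _)
    (fun D => missWeight_nonneg (fun s => (hM.weight_mem s).1) _ _) (κ := 1 / 4) (by norm_num)
    (fun D => by
      rw [h3, missWeight_add_not, hM.sum_stateLaw_worst, hs, mul_one]
      exact hγ h) hB hBle
  refine le_trans (ENNReal.ofReal_le_ofReal ?_) hmain
  linarith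

/-- The minimax risk of a sign family is at least of the order `H η`. -/
lemma le_minimaxRisk (hM : IsSignFamily η ρ γ u W M) (hd : 1 ≤ d) (hη : K * η ^ 2 ≤ d ^ 3 / 2)
    (hK : 1 ≤ K) (hγ : ∀ h, 1 / 4 ≤ ∏ t ∈ Finset.range h, γ t) {s : Fin 2} (hs : u s = 1)
    {𝓜 : Set (LinearDRMDP φ H)} (h𝓜 : ∀ ξ, M ξ ∈ 𝓜) :
    ENNReal.ofReal (7 / 256 * (H * η))
      ≤ LinearDRMDP.minimaxRisk 𝓜 ρ (hardInit d) (hardBehavior d) K s := by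
  refine le_iInf₂ fun πhat hπ => ?_
  set R := ⨆ N ∈ 𝓜, ∫⁻ D, ENNReal.ofReal (N.subOpt ρ (πhat D) s)
    ∂N.dataLaw (hardInit d) (hardBehavior d) K
  have hd0 : (0 : ℝ) < d := by exact_mod_cast hd
  have hη0 := hM.scale_nonneg
  -- sign vectors for all steps from the bits at the steps `h < H`
  let bits : (Fin H × Fin d → Bool) → ℕ → Fin d → Bool :=
    fun β h i => if hh : h < H then β (⟨h, hh⟩, i) else false
  have hbits : ∀ β (j : Fin H × Fin d), bits β j.1 j.2 = β j := fun β j => by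
    simp [bits]
  have h := assouad (R := R) (ε := ENNReal.ofReal (η / (2 * d)) * ENNReal.ofReal (7 / 64))
    (fun β j => ENNReal.ofReal (η / (2 * d))
      * ∫⁻ D, ENNReal.ofReal (missWeight u W s j.1 j.2 (bits β j.1 j.2) (πhat D))
          ∂(M (bits β)).dataLaw (hardInit d) (hardBehavior d) K) (fun β => ?_) (fun β j => ?_)
  · rw [Fintype.card_prod, Fintype.card_fin, Fintype.card_fin, ← ENNReal.ofReal_mul (by positivity),
      ← ENNReal.ofReal_natCast, ← ENNReal.ofReal_mul (by positivity)] at h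
    rw [← ENNReal.mul_le_mul_iff_right two_ne_zero ENNReal.ofNat_ne_top]
    refine le_trans (le_of_eq ?_) h
    rw [← ENNReal.ofReal_ofNat, ← ENNReal.ofReal_mul (by norm_num)]
    congr 1
    push_cast
    field_simp
    ring
  · have hmeas : ∀ j : Fin H × Fin d, Measurable fun D =>
        ENNReal.ofReal (missWeight u W s j.1 j.2 (bits β j.1 j.2) (πhat D)) := fun j =>
      ((measurable_missWeight _).comp hπ).ennreal_ofReal
    simp_rw [← lintegral_const_mul _ (hmeas _)]
    rw [← lintegral_finsetSum _ fun j _ => (hmeas j).const_mul _]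
    refine le_trans (lintegral_mono fun D => ?_) (le_iSup₂_of_le (M (bits β)) (h𝓜 _) le_rfl)
    rw [← Finset.sum_congr rfl fun j _ => ENNReal.ofReal_mul (by positivity),
      ← ENNReal.ofReal_sum_of_nonneg fun j _ => mul_nonneg (by positivity)
        (missWeight_nonneg (fun s => (hM.weight_mem s).1) _ _)]
    refine ENNReal.ofReal_le_ofReal ?_
    rw [← value_signLoss_eq]
    exact hM.le_subOpt _ _ _
  · rw [← mul_add]
    refine mul_le_mul_right (hM.two_point hη hK hγ hs hπ (fun t ht => ?_) (fun i hi => ?_) ?_) _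
    · funext i
      simp only [bits]
      split_ifs with hh
      · rw [Function.update_of_ne]
        rintro rfl
        exact ht rfl
      · rfl
    · simp only [bits]
      split_ifs with hh
      · rw [Function.update_of_ne]
        rintro e
        exact hi (congrArg Prod.snd e)
      · rfl
    · rw [hbits, hbits, Function.update_self]

end IsSignFamily

/-! ### The lower bound for a sign family -/

lemma hardInit_zero (d : ℕ) : (hardInit d).1 0 = ((d : ℝ) + 1) / (d + 2) := rfl

lemma hardInit_one (d : ℕ) : (hardInit d).1 1 = 1 / ((d : ℝ) + 2) := rfl

namespace IsSignFamily

variable {d H K : ℕ} {φ : Fin 2 → (Fin d → Bool) → Distr (Fin (d + 2))} {η : ℝ}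
  {ρ γ : ℕ → ℝ} {u : Fin 2 → ℝ} {W : Transition (Fin 2) (Fin d → Bool)}
  {M : (ℕ → Fin d → Bool) → LinearDRMDP φ H}

lemma expect_probe_zero (hM : IsSignFamily η ρ γ u W M) (ξ : ℕ → Fin d → Bool) (k : ℕ)
    (o : Option (Fin d)) :
    expect (hardBehavior d) (M ξ).nominal 0 (hardInit d).1 k
      (fun s a => if s = 0 ∧ a = probe o then 1 else 0) = 1 / ((d : ℝ) + 2) := by
  rw [hM.expect_hardBehavior, Fin.sum_univ_two]
  simp only [probe_injective.eq_iff, true_and, one_ne_zero, false_and, if_false, Finset.sum_ite_eq',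
    Finset.mem_univ, if_true, Finset.sum_const_zero, zero_div, mul_zero, add_zero, hardInit_zero]
  field_simp

lemma expect_probe_one (hM : IsSignFamily η ρ γ u W M) (ξ : ℕ → Fin d → Bool) (k : ℕ) :
    expect (hardBehavior d) (M ξ).nominal 0 (hardInit d).1 k
      (fun s a => if s = 1 ∧ a = probe none then 1 else 0) = 1 / (((d : ℝ) + 1) * (d + 2)) := by
  rw [hM.expect_hardBehavior, Fin.sum_univ_two]
  simp only [probe_injective.eq_iff, true_and, zero_ne_one, false_and, if_false, Finset.sum_ite_eq',
    Finset.mem_univ, if_true, Finset.sum_const_zero, zero_div, mul_zero, zero_add, hardInit_one]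
  field_simp

/-- The second moments of the features are positive definite, by the same coordinate bound that
controls the empirical covariance. -/
lemma posDef_featureCov (hM : IsSignFamily η ρ γ u W M) (hd : 1 ≤ d) (ξ : ℕ → Fin d → Bool)
    (h : ℕ) : ((M ξ).featureCov (hardInit d) (hardBehavior d) h).PosDef := by
  have hquad : ∀ y : Fin (d + 2) → ℝ,
      y ⬝ᵥ ((M ξ).featureCov (hardInit d) (hardBehavior d) h).mulVec y
        = ∑ s, ∑ a, ((hardInit d).1 s * (hardBehavior d h s).1 a) * ((φ s a).1 ⬝ᵥ y) ^ 2 := by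
    intro y
    have e : (M ξ).featureCov (hardInit d) (hardBehavior d) h
        = ∑ s, ∑ a, ((hardInit d).1 s * (hardBehavior d h s).1 a)
          • Matrix.vecMulVec (φ s a).1 (φ s a).1 := by
      ext i j
      simp only [LinearDRMDP.featureCov, expect, hM.stateLaw_hardBehavior, zero_add,
        Matrix.of_apply, Matrix.sum_apply, Matrix.smul_apply, Matrix.vecMulVec_apply, smul_eq_mul]
    rw [e]
    simp only [Matrix.sum_mulVec, Matrix.smul_mulVec, dotProduct_sum, dotProduct_smul,
      LinearDRMDP.dotProduct_vecMulVec_mulVec, smul_eq_mul]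
  refine Matrix.PosDef.of_dotProduct_mulVec_pos ?_ ?_
  · ext i j
    simp [LinearDRMDP.featureCov, mul_comm]
  · intro y hy
    rw [star_trivial, hquad]
    set Q := ∑ s, ∑ a, ((hardInit d).1 s * (hardBehavior d h s).1 a) * ((φ s a).1 ⬝ᵥ y) ^ 2
    have hc : ∀ s a, 0 ≤ (hardInit d).1 s * (hardBehavior d h s).1 a := fun s a =>
      mul_nonneg ((hardInit d).2.1 s) ((hardBehavior d h s).2.1 a)
    have hQ0 : 0 ≤ Q := Finset.sum_nonneg fun s _ => Finset.sum_nonneg fun a _ =>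
      mul_nonneg (hc s a) (sq_nonneg _)
    have hprobe : ∀ s o, (hardBehavior d h s).1 (probe o) = 1 / ((d : ℝ) + 1) := fun s o => by
      have := sum_hardBehavior h s fun a => if a = probe o then 1 else 0
      simpa [probe_injective.eq_iff] using this
    refine hQ0.lt_of_ne fun hQ => hy ?_
    funext i
    have h1 := sq_coord_le hd (w := 1 / (d + 2)) (w' := 1 / ((d + 1) * (d + 2))) (by positivity)
      (by positivity) (sum_mul_sq_feature_ge hM.feature_zero hM.feature_one hc
        (fun o => by rw [hprobe, hardInit_zero]; apply le_of_eq; field_simp)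
        (by rw [hprobe, hardInit_one]; apply le_of_eq; field_simp) y) i
    change y i ^ 2 ≤ _ * Q at h1
    rw [← hQ, mul_zero] at h1
    exact pow_eq_zero_iff two_ne_zero |>.1 (le_antisymm h1 (sq_nonneg _))

/-- If all pairs on which the features are determined are visited sufficiently often, the uncertainty
function is at most of the order `H η`, for every policy. -/
lemma uncertainty_le (hM : IsSignFamily η ρ γ u W M) (hd : 1 ≤ d) (hK : 1 ≤ K)
    (hη : K * η ^ 2 = d ^ 3 / 2) {D : Dataset (Fin 2) (Fin d → Bool) H K}
    (h0 : ∀ h o, K * (1 / ((d : ℝ) + 2)) / 2 ≤ visitCount D h 0 (probe o))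
    (h1 : ∀ h, K * (1 / (((d : ℝ) + 1) * (d + 2))) / 2 ≤ visitCount D h 1 (probe none))
    (ξ : ℕ → Fin d → Bool) {lam : ℝ} (hlam : 0 < lam) (π : Policy (Fin 2) (Fin d → Bool))
    (s : Fin 2) : (M ξ).uncertainty ρ lam D π s ≤ H * (5 * η) := by
  have hd1 : (1 : ℝ) ≤ d := by exact_mod_cast hd
  have hK1 : (1 : ℝ) ≤ K := by exact_mod_cast hK
  -- the diagonal of the inverse covariance is at most `12 d ^ 3 / K ≤ 25 η ^ 2`
  refine (M ξ).uncertainty_le ρ lam D π s (by have := hM.scale_nonneg; positivity) fun h i => ?_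
  have htv := fun s a => hM.truncVar_eq_one ξ h s a
  have hη2 : η ^ 2 = d ^ 3 / (2 * K) := by
    field_simp
    linarith
  refine dotProduct_inv_mulVec_le ((M ξ).posDef_weightedCov htv hlam D) _ (by positivity)
    fun y => ?_
  have hQ : ∑ s, ∑ a, (visitCount D h s a : ℝ) * ((φ s a).1 ⬝ᵥ y) ^ 2
      ≤ y ⬝ᵥ ((M ξ).weightedCov ρ lam D h).mulVec y := by
    rw [(M ξ).dotProduct_weightedCov_mulVec htv,
      sum_eq_sum_visitCount D h fun s a => ((φ s a).1 ⬝ᵥ y) ^ 2]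
    have : 0 ≤ y ⬝ᵥ y := Finset.sum_nonneg fun j _ => mul_self_nonneg _
    have := mul_nonneg hlam.le this
    linarith
  have hQ' := (sum_mul_sq_feature_ge hM.feature_zero hM.feature_one
    (fun s a => Nat.cast_nonneg (visitCount D h s a)) (h0 h) (h1 h) y).trans hQ
  have hcoord := sq_coord_le hd (by positivity) (by positivity) hQ' i
  rw [single_one_dotProduct]
  have hQ0 : 0 ≤ y ⬝ᵥ ((M ξ).weightedCov ρ lam D h).mulVec y := le_trans (by positivity) hQ'
  refine hcoord.trans (mul_le_mul_of_nonneg_right (max_le ?_ ?_) hQ0)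
  · rw [mul_pow, hη2, div_le_iff₀ (by positivity)]
    field_simp
    nlinarith
  · rw [mul_pow, hη2, div_le_iff₀ (by positivity)]
    field_simp
    nlinarith [mul_nonneg (sub_nonneg.2 hd1) (sub_nonneg.2 hd1),
      mul_le_mul_of_nonneg_left hd1 (sq_nonneg (d : ℝ))]

/-- With high probability all pairs on which the features are determined are visited sufficiently
often. -/
lemma le_dataLaw_visitCount (hM : IsSignFamily η ρ γ u W M) (ξ : ℕ → Fin d → Bool) {δ : ℝ}
    (hδ : 0 ≤ δ)
    (hK : H * (d + 2) * Real.exp (-(K * (1 / (((d : ℝ) + 1) * (d + 2))) / 8)) ≤ δ) :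
    ENNReal.ofReal (1 - δ) ≤ (M ξ).dataLaw (hardInit d) (hardBehavior d) K
      {D | (∀ h o, K * (1 / ((d : ℝ) + 2)) / 2 ≤ visitCount D h 0 (probe o))
        ∧ ∀ h, K * (1 / (((d : ℝ) + 1) * (d + 2))) / 2 ≤ visitCount D h 1 (probe none)} := by
  set μ := (M ξ).dataLaw (hardInit d) (hardBehavior d) K
  set G : Set (Dataset (Fin 2) (Fin d → Bool) H K) :=
    {D | (∀ h o, K * (1 / ((d : ℝ) + 2)) / 2 ≤ visitCount D h 0 (probe o))
        ∧ ∀ h, K * (1 / (((d : ℝ) + 1) * (d + 2))) / 2 ≤ visitCount D h 1 (probe none)} with hG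
  set e := Real.exp (-(K * (1 / (((d : ℝ) + 1) * (d + 2))) / 8)) with he
  -- the events that a given pair is visited too rarely at a given step
  let B : Fin H × Option (Option (Fin d)) → Set (Dataset (Fin 2) (Fin d → Bool) H K) := fun j =>
    match j.2 with
    | none => {D | (visitCount D j.1 1 (probe none) : ℝ) < K * (1 / (((d : ℝ) + 1) * (d + 2))) / 2}
    | some o => {D | (visitCount D j.1 0 (probe o) : ℝ) < K * (1 / ((d : ℝ) + 2)) / 2}
  have hsub : Gᶜ ⊆ ⋃ j, B j := by
    intro D hD
    rw [Set.mem_iUnion]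
    by_contra hB
    push Not at hB
    refine hD ⟨fun h o => not_lt.1 (hB (h, some o)), fun h => not_lt.1 (hB (h, none))⟩
  have hB : ∀ j, μ (B j) ≤ ENNReal.ofReal e := by
    rintro ⟨h, _ | o⟩
    · exact dataLaw_visitCount_lt_le (M ξ) (hardInit d) (hardBehavior d) h 1 (probe none)
        (by positivity) (hM.expect_probe_one ξ h).ge
    · refine (dataLaw_visitCount_lt_le (M ξ) (hardInit d) (hardBehavior d) h 0 (probe o)
        (by positivity) (hM.expect_probe_zero ξ h o).ge).trans
        (ENNReal.ofReal_le_ofReal (Real.exp_le_exp.2 (neg_le_neg ?_)))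
      gcongr
      nlinarith [(Nat.cast_nonneg d : (0 : ℝ) ≤ d)]
  have hGc : μ Gᶜ ≤ ENNReal.ofReal δ := by
    refine (measure_mono hsub).trans ((measure_iUnion_fintype_le _ _).trans
      ((Finset.sum_le_sum fun j _ => hB j).trans ?_))
    rw [Finset.sum_const, Finset.card_univ, nsmul_eq_mul, Fintype.card_prod, Fintype.card_fin,
      Fintype.card_option, Fintype.card_option, Fintype.card_fin, ← ENNReal.ofReal_natCast,
      ← ENNReal.ofReal_mul (by positivity)]
    refine ENNReal.ofReal_le_ofReal (le_trans (le_of_eq ?_) hK)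
    push_cast
    ring
  rw [ENNReal.ofReal_sub _ hδ, ENNReal.ofReal_one, tsub_le_iff_right]
  calc (1 : ℝ≥0∞) = μ (G ∪ Gᶜ) := by rw [Set.union_compl_self, measure_univ]
    _ ≤ μ G + μ Gᶜ := measure_union_le _ _
    _ ≤ _ := by gcongr

/-- A sign family satisfies the lower bound: the minimax risk is at least of the order `H η`, and with
high probability the uncertainty functions are at most of this order. -/
theorem hasLowerBound (hM : IsSignFamily η ρ γ u W M) (hd : 1 ≤ d) (hK : 1 ≤ K)
    (hη : K * η ^ 2 = d ^ 3 / 2) (hγ : ∀ h, 1 / 4 ≤ ∏ t ∈ Finset.range h, γ t) {T : Set (Fin 2)}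
    (hT : ∀ s ∈ T, u s = 1) {δ : ℝ} (hδ : 0 ≤ δ)
    (hKδ : H * (d + 2) * Real.exp (-(K * (1 / (((d : ℝ) + 1) * (d + 2))) / 8)) ≤ δ) :
    LinearDRMDP.HasLowerBound (Set.range M) ρ (hardInit d) (hardBehavior d) K T (1 / 200) δ := by
  refine ⟨Set.range_nonempty M, ?_, ?_, ?_⟩
  · rintro _ ⟨ξ, rfl⟩ h _
    exact hM.posDef_featureCov hd ξ h
  · rintro _ ⟨ξ, rfl⟩
    exact ⟨_, hM.isOptimal_greedy ξ⟩
  · rintro lam hlam _ ⟨ξ₀, rfl⟩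
    refine (hM.le_dataLaw_visitCount ξ₀ hδ hKδ).trans (measure_mono ?_)
    rintro D ⟨h0, h1⟩ s hs _ ⟨ξ, rfl⟩ π _
    refine le_trans (ENNReal.ofReal_le_ofReal ?_)
      (hM.le_minimaxRisk hd hη.le hK hγ (hT s hs) fun ξ => ⟨ξ, rfl⟩)
    have h := hM.uncertainty_le hd hK hη h0 h1 ξ hlam π s
    have := mul_nonneg (Nat.cast_nonneg H : (0 : ℝ) ≤ H) hM.scale_nonneg
    linarith

end IsSignFamily

/-! ### The two constructions -/

section Models

variable {d H : ℕ}

/-- The model with the given parameters, for reward parameters in `[0, 1]`. -/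
def modelOfUnit {n : ℕ} {S A : Type*} [Fintype S] (φ : S → A → Distr (Fin n)) (H : ℕ)
    (θ : ℕ → Fin n → ℝ) (hθ : ∀ h i, θ h i ∈ Set.Icc (0 : ℝ) 1) (μ : ℕ → Fin n → Distr S) :
    LinearDRMDP φ H where
  θ := θ
  μ := μ
  θ_norm_le h _ := by
    refine Real.sqrt_le_sqrt ?_
    calc ∑ i, θ h i ^ 2 ≤ ∑ _i : Fin n, (1 : ℝ) := Finset.sum_le_sum fun i _ =>
          pow_le_one₀ (hθ h i).1 (hθ h i).2
      _ = n := by simp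
  reward_mem h _ s a := ⟨(φ s a).le_sum_mul fun i => (hθ h i).1,
    (φ s a).sum_mul_le fun i => (hθ h i).2⟩

/-- The reward parameters `η ((b₁ + 1) / 2, …, (b_d + 1) / 2, 1 / 2)`, with last entry `t`. -/
def signTheta (η t : ℝ) (b : Fin d → Bool) : Fin (d + 2) → ℝ :=
  Fin.snoc (α := fun _ => ℝ) (Fin.snoc (α := fun _ => ℝ)
    (fun i : Fin d => η * ((if b i then (1 : ℝ) else -1) + 1) / 2) (η / 2)) t

lemma signTheta_mem {η t : ℝ} (h0 : 0 ≤ η) (h1 : η ≤ 1) (ht : t ∈ Set.Icc (0 : ℝ) 1)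
    (b : Fin d → Bool) (i : Fin (d + 2)) : signTheta η t b i ∈ Set.Icc (0 : ℝ) 1 := by
  refine Fin.lastCases ?_ (fun i => Fin.lastCases ?_ (fun i => ?_) i) i
  · simpa [signTheta] using ht
  · simp only [signTheta, Fin.snoc_castSucc, Fin.snoc_last]
    constructor <;> linarith
  · simp only [signTheta, Fin.snoc_castSucc]
    split_ifs <;> constructor <;> linarith

lemma sum_hardFeature_mul_signTheta (hd : 1 ≤ d) (η t : ℝ) (b a : Fin d → Bool) :
    ∑ i, (hardFeature d 0 a).1 i * signTheta η t b i = signReward η b a := by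
  have hd0 : (d : ℝ) ≠ 0 := by positivity
  rw [Fin.sum_univ_castSucc, Fin.sum_univ_castSucc, hardFeature_zero_last,
    hardFeature_zero_castSucc_last]
  simp_rw [hardFeature_zero_castSucc_castSucc]
  simp only [signTheta, Fin.snoc_castSucc, Fin.snoc_last, signReward, zero_mul, add_zero]
  rw [sub_mul, Finset.sum_mul, mul_add, Finset.mul_sum, one_mul, add_sub, add_comm _ (η / 2),
    ← add_sub, ← Finset.sum_sub_distrib]
  congr 1
  · ring
  · refine Finset.sum_congr rfl fun i _ => ?_
    cases a i <;> cases b i <;> simp <;> field_simp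
    ring

lemma tvDist_self {S : Type*} [Fintype S] (p : Distr S) : tvDist p p = 0 := by
  simp [tvDist]

/-! ### Rewards that do not depend on the state -/

/-- A feature map whose features at the second state arise from those at the first state by
exchanging the last two coordinates. -/
def symmFeature (d : ℕ) (s : Fin 2) (a : Fin d → Bool) : Distr (Fin (d + 2)) :=
  if s = 0 then hardFeature d 0 a else
    ⟨fun i => (hardFeature d 0 a).1 (Equiv.swap (Fin.last d).castSucc (Fin.last (d + 1)) i),
      fun _ => (hardFeature d 0 a).2.1 _, by
        rw [Equiv.sum_comp (Equiv.swap (Fin.last d).castSucc (Fin.last (d + 1)))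
          (hardFeature d 0 a).1]
        exact (hardFeature d 0 a).2.2⟩

lemma symmFeature_one_apply (a : Fin d → Bool) (i : Fin (d + 2)) :
    (symmFeature d 1 a).1 i
      = (hardFeature d 0 a).1 (Equiv.swap (Fin.last d).castSucc (Fin.last (d + 1)) i) := rfl

/-- With the last entry `η / 2` the reward parameters do not change when the last two coordinates are
exchanged, hence the rewards in the two states agree. -/
lemma signTheta_swap (η : ℝ) (b : Fin d → Bool) (i : Fin (d + 2)) :
    signTheta η (η / 2) b (Equiv.swap (Fin.last d).castSucc (Fin.last (d + 1)) i)
      = signTheta η (η / 2) b i := by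
  rw [Equiv.swap_apply_def]
  split_ifs with h1 h2
  · rw [h1]; simp [signTheta]
  · rw [h2]; simp [signTheta]
  · rfl

lemma symmFeature_one_probe_none : symmFeature d 1 (probe none) = dirac (Fin.last (d + 1)) := by
  refine Subtype.ext (funext fun i => ?_)
  rw [symmFeature_one_apply]
  have key : ∀ j, (hardFeature d 0 (probe none)).1 j
      = if j = (Fin.last d).castSucc then 1 else 0 := by
    intro j
    refine Fin.lastCases ?_ (fun j => Fin.lastCases ?_ (fun j => ?_) j) j
    · rw [hardFeature_zero_last, if_neg]
      exact (Fin.castSucc_lt_last _).ne'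
    · rw [hardFeature_zero_castSucc_last]
      simp [probe]
    · have hj : j.castSucc.castSucc ≠ (Fin.last d).castSucc := by
        rw [Ne, Fin.castSucc_inj]
        exact (Fin.castSucc_lt_last _).ne
      rw [hardFeature_zero_castSucc_castSucc, if_neg hj]
      simp [probe]
  rw [key]
  simp only [dirac, Pi.single_apply]
  congr 1
  rw [Equiv.swap_apply_eq_iff, Equiv.swap_apply_left]

/-- The model with the same rewards in both states, in which the state is drawn afresh from
`hardInit` at every step. -/
def symmModel (d H : ℕ) {η : ℝ} (h0 : 0 ≤ η) (h1 : η ≤ 1) (ξ : ℕ → Fin d → Bool) :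
    LinearDRMDP (symmFeature d) H :=
  modelOfUnit (symmFeature d) H (fun h => signTheta η (η / 2) (ξ h))
    (fun h => signTheta_mem h0 h1 ⟨by linarith, by linarith⟩ (ξ h)) fun _ _ => hardInit d

lemma nominal_symmModel {η : ℝ} (h0 : 0 ≤ η) (h1 : η ≤ 1) (ξ : ℕ → Fin d → Bool) :
    (symmModel d H h0 h1 ξ).nominal = fun _ _ _ => hardInit d := by
  funext h s a
  refine Subtype.ext (funext fun s' => ?_)
  exact Distr.sum_mul_const (symmFeature d s a) _

/-- Here the transitions have no influence on the rewards, so that `u = 1` and nothing is lost. -/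
lemma isSignFamily_symmModel (hd : 1 ≤ d) {η : ℝ} (h0 : 0 ≤ η) (h1 : η ≤ 1) {ρ : ℝ} (hρ : 0 ≤ ρ) :
    IsSignFamily η (fun _ => ρ) (fun _ => 1) (fun _ => 1) (fun _ _ _ => hardInit d)
      (symmModel d H h0 h1) where
  scale_nonneg := h0
  feature_zero _ := rfl
  feature_one := symmFeature_one_probe_none
  nominal_eq ξ ξ' := by rw [nominal_symmModel, nominal_symmModel]
  stationary ξ h s' := by
    rw [nominal_symmModel]
    simp_rw [mul_assoc, ← Finset.mul_sum, Distr.sum_mul_const]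
  reward_eq ξ h s a := by
    rw [one_mul, ← sum_hardFeature_mul_signTheta hd η (η / 2)]
    fin_cases s
    · rfl
    · rw [← Equiv.sum_comp (Equiv.swap (Fin.last d).castSucc (Fin.last (d + 1)))]
      refine Finset.sum_congr rfl fun i _ => ?_
      rw [signTheta_swap]
      rfl
  weight_mem _ := ⟨zero_le_one, le_rfl⟩
  variance_weight ξ h s a := by simp only [one_pow, Distr.sum_mul_const]
  factor_nonneg _ := zero_le_one
  worst_mem ξ h s a := by
    refine ⟨fun _ => hardInit d, fun i => (tvDist_self _).le.trans hρ, ?_⟩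
    exact (congrFun (congrFun (congrFun (nominal_symmModel (H := H) h0 h1 ξ) h) s) a).symm
  worst_eq h s a := by rw [Distr.sum_mul_const, one_mul]
  le_of_mem ξ P _ h s a := by rw [Distr.sum_mul_const, one_mul]

/-! ### The absorbing second state -/

/-- The uncertainty level that is `ρ` at the first step and `0` later. -/
abbrev firstLevel (ρ : ℝ) : ℕ → ℝ := fun h => if h = 0 then ρ else 0

/-- The factor distributions with the value `p` except for the last one, which is the point mass at
the second state. -/
def absorbingFactors (d : ℕ) (p : Distr (Fin 2)) : Fin (d + 2) → Distr (Fin 2) :=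
  Fin.snoc (α := fun _ => Distr (Fin 2)) (fun _ : Fin (d + 1) => p) (dirac 1)

lemma mix_absorbingFactors (p : Distr (Fin 2)) (s : Fin 2) (a : Fin d → Bool) :
    mix (hardFeature d s a) (absorbingFactors d p) = if s = 0 then p else dirac 1 := by
  refine Subtype.ext (funext fun s' => ?_)
  fin_cases s
  · have h := (hardFeature d 0 a).2.2
    rw [Fin.sum_univ_castSucc, hardFeature_zero_last, add_zero] at h
    simp only [mix, absorbingFactors]
    rw [Fin.sum_univ_castSucc]
    simp only [Fin.snoc_castSucc, Fin.snoc_last, Fin.zero_eta, Fin.isValue, if_true]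
    rw [← Finset.sum_mul, h, hardFeature_zero_last, zero_mul, add_zero, one_mul]
  · simp only [mix, absorbingFactors, hardFeature]
    rw [Finset.sum_eq_single (Fin.last (d + 1))]
    · simp [dirac]
    · intro i _ hi
      simp [dirac, Pi.single_eq_of_ne hi]
    · simp

/-- The hard instance with the sign vectors `ξ`. -/
def hardModel (d H : ℕ) {η : ℝ} (h0 : 0 ≤ η) (h1 : η ≤ 1) (ξ : ℕ → Fin d → Bool) :
    LinearDRMDP (hardFeature d) H :=
  modelOfUnit (hardFeature d) H (fun h => signTheta η 0 (ξ h))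
    (fun h => signTheta_mem h0 h1 ⟨le_rfl, zero_le_one⟩ (ξ h)) fun _ => absorbingFactors d (dirac 0)

lemma isHardInstance_hardModel {η : ℝ} (h0 : 0 ≤ η) (h1 : η ≤ 1) (ξ : ℕ → Fin d → Bool) :
    IsHardInstance η ξ (hardModel d H h0 h1 ξ) := ⟨fun _ => rfl, fun _ => rfl⟩

lemma hardClass_eq_range {η : ℝ} (h0 : 0 ≤ η) (h1 : η ≤ 1) :
    hardClass d H η = Set.range (hardModel d H h0 h1) := by
  ext N
  constructor
  · rintro ⟨ξ, hθ, hμ⟩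
    refine ⟨ξ, ?_⟩
    obtain ⟨θ, μ, _, _⟩ := N
    obtain rfl : θ = fun h => signTheta η 0 (ξ h) := funext hθ
    obtain rfl : μ = fun _ => absorbingFactors d (dirac 0) := funext hμ
    rfl
  · rintro ⟨ξ, rfl⟩
    exact ⟨ξ, isHardInstance_hardModel h0 h1 ξ⟩

lemma nominal_hardModel {η : ℝ} (h0 : 0 ≤ η) (h1 : η ≤ 1) (ξ : ℕ → Fin d → Bool) :
    (hardModel d H h0 h1 ξ).nominal = fun _ s _ => dirac s := by
  funext h s a
  refine (mix_absorbingFactors (dirac 0) s a).trans ?_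
  fin_cases s <;> rfl

/-- The distribution `(1 - t, t)` on the two states. -/
def leak (t : ℝ) (h0 : 0 ≤ t) (h1 : t ≤ 1) : Distr (Fin 2) :=
  ⟨![1 - t, t], fun s => by fin_cases s <;> simp <;> linarith, by simp [Fin.sum_univ_two]⟩

lemma one_sub_le_of_tvDist_dirac_le {p : Distr (Fin 2)} {t : ℝ} (h : tvDist p (dirac 0) ≤ t) :
    1 - t ≤ p.1 0 := by
  have hs := p.2.2
  rw [Fin.sum_univ_two] at hs
  simp only [tvDist, dirac, Fin.sum_univ_two, Pi.single_eq_same,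
    Pi.single_eq_of_ne one_ne_zero, sub_zero] at h
  have h1 := neg_abs_le (p.1 0 - 1)
  have h2 := le_abs_self (p.1 1)
  linarith

/-- Here `u` is the indicator of the first state. The worst kernel sends the mass `ρ` from the first
to the absorbing second state at the first step, whatever the action is. -/
lemma isSignFamily_hardModel (hd : 1 ≤ d) {η : ℝ} (h0 : 0 ≤ η) (h1 : η ≤ 1) {ρ : ℝ} (hl0 : ∀ h, 0 ≤ firstLevel ρ h) (hl1 : ∀ h, firstLevel ρ h ≤ 1) :
    IsSignFamily η (firstLevel ρ) (fun h => 1 - firstLevel ρ h) ![1, 0]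
      (fun h s _ => if s = 0 then leak (firstLevel ρ h) (hl0 h) (hl1 h) else dirac 1)
      (hardModel d H h0 h1) where
  scale_nonneg := h0
  feature_zero _ := rfl
  feature_one := rfl
  nominal_eq ξ ξ' := by rw [nominal_hardModel, nominal_hardModel]
  stationary ξ h s' := by
    rw [nominal_hardModel]
    simp_rw [mul_assoc, ← Finset.mul_sum, Distr.sum_mul_const]
    simp [dirac, Pi.single_apply]
  reward_eq ξ h s a := by
    fin_cases s
    · exact (sum_hardFeature_mul_signTheta hd η 0 (ξ h) a).trans (one_mul _).symm
    · simp only [LinearDRMDP.reward, hardModel, modelOfUnit, hardFeature, dirac]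
      rw [Finset.sum_eq_single (Fin.last (d + 1))]
      · simp [signTheta]
      · intro i _ hi
        simp [Pi.single_eq_of_ne hi]
      · simp
  weight_mem s := by fin_cases s <;> simp
  variance_weight ξ h s a := by
    rw [nominal_hardModel]
    fin_cases s <;> simp [dirac, Fin.sum_univ_two]
  factor_nonneg h := sub_nonneg.2 (hl1 h)
  worst_mem ξ h s a := by
    refine ⟨absorbingFactors d (leak (firstLevel ρ h) (hl0 h) (hl1 h)), fun i => ?_,
      (mix_absorbingFactors _ s a).symm⟩
    change tvDist _ (absorbingFactors d (dirac 0) i) ≤ _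
    refine Fin.lastCases ?_ (fun i => ?_) i
    · simp only [absorbingFactors, Fin.snoc_last]
      rw [tvDist_self]
      exact hl0 h
    · simp only [absorbingFactors, Fin.snoc_castSucc]
      have := abs_of_nonneg (hl0 h)
      simp only [tvDist, leak, dirac, Fin.sum_univ_two, Matrix.cons_val_zero, Matrix.cons_val_one,
        Pi.single_eq_same, Pi.single_eq_of_ne one_ne_zero, sub_zero]
      rw [show 1 - firstLevel ρ h - 1 = -firstLevel ρ h by ring, abs_neg, this]
      linarith
  worst_eq h s a := by
    fin_cases s <;> simp [leak, dirac, Fin.sum_univ_two]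
  le_of_mem ξ P hP h s a := by
    obtain ⟨ν, hν, hPe⟩ := hP h s a
    rw [Fin.sum_univ_two]
    simp only [Matrix.cons_val_zero, Matrix.cons_val_one, mul_one, mul_zero, add_zero]
    fin_cases s
    · simp only [Fin.zero_eta, Matrix.cons_val_zero, mul_one]
      have hPe' : P h 0 a = mix (hardFeature d 0 a) ν := hPe
      rw [hPe', ← (hardFeature d 0 a).sum_mul_const (1 - firstLevel ρ h)]
      refine Finset.sum_le_sum fun i _ => ?_
      refine Fin.lastCases ?_ (fun i => ?_) i
      · rw [hardFeature_zero_last, zero_mul]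
        exact le_of_eq (by simp)
      · refine mul_le_mul_of_nonneg_left (one_sub_le_of_tvDist_dirac_le ?_)
          ((hardFeature d 0 a).2.1 _)
        have := hν i.castSucc
        simpa only [hardModel, modelOfUnit, absorbingFactors, Fin.snoc_castSucc] using this
    · simpa using (P h 1 a).2.1 0

end Models

section Numerics

lemma scale_sq (d K : ℕ) (hK : 1 ≤ K) :
    K * ((d : ℝ) ^ (3 / 2 : ℝ) / √(2 * K)) ^ 2 = d ^ 3 / 2 := by
  have hK0 : (0 : ℝ) < K := by exact_mod_cast hK
  rw [div_pow, Real.sq_sqrt (by positivity), ← Real.rpow_natCast, ← Real.rpow_mul (by positivity)]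
  have : (d : ℝ) ^ (3 / 2 * ((2 : ℕ) : ℝ)) = (d : ℝ) ^ 3 := by
    rw [← Real.rpow_natCast (d : ℝ) 3]
    norm_num
  rw [this]
  field_simp

/-- The union bound over the steps and the `d + 2` pairs. -/
lemma failure_le {d H K : ℕ} {δ : ℝ} (hd : 1 ≤ d) (hH : 1 ≤ H) (hδ : 0 < δ) (hδ1 : δ < 1)
    (hK : 1000 * (d : ℝ) ^ 6 * Real.log (2 * d * H / δ) < K) :
    H * (d + 2) * Real.exp (-(K * (1 / (((d : ℝ) + 1) * (d + 2))) / 8)) ≤ δ := by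
  have hd1 : (1 : ℝ) ≤ d := by exact_mod_cast hd
  have hH1 : (1 : ℝ) ≤ H := by exact_mod_cast hH
  have hdH : 1 ≤ (d : ℝ) * H := one_le_mul_of_one_le_of_one_le hd1 hH1
  have hx : 1 ≤ 2 * d * H / δ := by
    rw [le_div_iff₀ hδ]
    nlinarith
  have hL : 0 ≤ Real.log (2 * d * H / δ) := Real.log_nonneg hx
  have hpow : (d : ℝ) ^ 2 ≤ (d : ℝ) ^ 6 := pow_le_pow_right₀ hd1 (by norm_num)
  -- the exponent is at least `2 log (2dH/δ)`, since `16 (d + 1) (d + 2) ≤ 1000 d ^ 6`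
  have hexp : 2 * Real.log (2 * d * H / δ) ≤ K * (1 / (((d : ℝ) + 1) * (d + 2))) / 8 := by
    rw [mul_one_div, div_div, le_div_iff₀ (by positivity)]
    have h1 : 2 * (((d : ℝ) + 1) * (d + 2) * 8) ≤ 1000 * (d : ℝ) ^ 6 := by nlinarith
    nlinarith [mul_le_mul_of_nonneg_right h1 hL]
  have h2 : Real.exp (-(K * (1 / (((d : ℝ) + 1) * (d + 2))) / 8)) ≤ (δ / (2 * d * H)) ^ 2 := by
    refine (Real.exp_le_exp.2 (neg_le_neg hexp)).trans (le_of_eq ?_)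
    rw [← Real.log_rpow (by linarith), ← Real.log_inv, Real.exp_log (by positivity),
      Real.rpow_two, ← inv_pow, inv_div]
  calc H * (d + 2) * Real.exp (-(K * (1 / (((d : ℝ) + 1) * (d + 2))) / 8))
      ≤ H * (d + 2) * (δ / (2 * d * H)) ^ 2 := by gcongr
    _ = δ * (δ * (d + 2) / (4 * (d ^ 2 * H))) := by field_simp; norm_num
    _ ≤ δ * 1 := by
        refine mul_le_mul_of_nonneg_left ?_ hδ.le
        rw [div_le_one (by positivity)]
        nlinarith [mul_le_mul_of_nonneg_left hdH (by linarith : (0 : ℝ) ≤ d)]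
    _ = δ := mul_one δ

lemma sample_size_bounds {d H K : ℕ} {δ : ℝ} (hd : 1 ≤ d) (hH : 1 ≤ H) (hδ : 0 < δ) (hδ1 : δ < 1)
    (hK : 1000 * (d : ℝ) ^ 6 * Real.log (2 * d * H / δ) < K) : 1 ≤ K ∧ (d : ℝ) ^ 3 / 2 ≤ K := by
  have hd1 : (1 : ℝ) ≤ d := by exact_mod_cast hd
  have hH1 : (1 : ℝ) ≤ H := by exact_mod_cast hH
  have hdH : 1 ≤ (d : ℝ) * H := one_le_mul_of_one_le_of_one_le hd1 hH1
  have hx : 2 ≤ 2 * d * H / δ := by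
    rw [le_div_iff₀ hδ]
    nlinarith
  have hL : 0.69 ≤ Real.log (2 * d * H / δ) := by
    have := Real.log_two_gt_d9
    have := Real.log_le_log two_pos hx
    linarith
  have h1 : 1 ≤ (d : ℝ) ^ 3 := one_le_pow₀ hd1
  have hpow : (d : ℝ) ^ 3 ≤ (d : ℝ) ^ 6 := pow_le_pow_right₀ hd1 (by norm_num)
  have h3 : (d : ℝ) ^ 3 ≤ K := by nlinarith
  exact ⟨by exact_mod_cast h1.trans h3, by linarith⟩

lemma quarter_le_prod_firstLevel {ρ : ℝ} (hρ1 : ρ ≤ 3 / 4) (h : ℕ) :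
    1 / 4 ≤ ∏ t ∈ Finset.range h, (1 - firstLevel ρ t) := by
  rcases h with _ | h
  · norm_num
  · rw [Finset.prod_range_succ']
    simp only [firstLevel, Nat.add_eq_zero_iff, one_ne_zero, and_false, if_false, sub_zero,
      Finset.prod_const_one, if_true, one_mul]
    linarith

end Numerics

end DRMDP

end

theorem mainTheorem3 :
    ∃ c > (0 : ℝ), ∃ C > (0 : ℝ),
      ∀ (ρ δ : ℝ) (d H K : ℕ), 0 < ρ → ρ ≤ 3 / 4 → 0 < δ → δ < 1 → 1 ≤ d → 1 ≤ H →
        C * (d : ℝ) ^ 6 * Real.log (2 * d * H / δ) < K →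
        (∃ (φ : Fin 2 → (Fin d → Bool) → DRMDP.Distr (Fin (d + 2)))
          (ν : DRMDP.Distr (Fin 2)) (πb : DRMDP.Policy (Fin 2) (Fin d → Bool))
          (𝓜 : Set (DRMDP.LinearDRMDP φ H)),
          DRMDP.LinearDRMDP.HasLowerBound 𝓜 (fun _ => ρ) ν πb K Set.univ c δ) ∧
        ((∀ ξ : ℕ → Fin d → Bool, ∃ M : DRMDP.LinearDRMDP (DRMDP.hardFeature d) H,
            DRMDP.IsHardInstance ((d : ℝ) ^ (3 / 2 : ℝ) / √(2 * K)) ξ M) ∧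
          DRMDP.LinearDRMDP.HasLowerBound
            (DRMDP.hardClass d H ((d : ℝ) ^ (3 / 2 : ℝ) / √(2 * K)))
            (fun h => if h = 0 then ρ else 0) (DRMDP.hardInit d) (DRMDP.hardBehavior d) K {0} c δ) := by
  refine ⟨1 / 200, by norm_num, 1000, by norm_num, ?_⟩
  intro ρ δ d H K hρ hρ1 hδ hδ1 hd hH hK
  obtain ⟨hK1, hKd⟩ := DRMDP.sample_size_bounds hd hH hδ hδ1 hK
  have hfail := DRMDP.failure_le hd hH hδ hδ1 hK
  have hη := DRMDP.scale_sq d K hK1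
  have hη0 : 0 ≤ (d : ℝ) ^ (3 / 2 : ℝ) / √(2 * K) := by positivity
  set η := (d : ℝ) ^ (3 / 2 : ℝ) / √(2 * K)
  have hη1 : η ≤ 1 := by
    have hK0 : (0 : ℝ) < K := by exact_mod_cast hK1
    have : η ^ 2 ≤ 1 := by nlinarith
    exact (sq_le_one_iff₀ hη0).1 this
  refine ⟨⟨DRMDP.symmFeature d, DRMDP.hardInit d, DRMDP.hardBehavior d,
    Set.range (DRMDP.symmModel d H hη0 hη1), ?_⟩, fun ξ =>
      ⟨_, DRMDP.isHardInstance_hardModel hη0 hη1 ξ⟩, ?_⟩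
  · exact (DRMDP.isSignFamily_symmModel hd hη0 hη1 hρ.le).hasLowerBound hd hK1 hη
      (fun h => by simp; norm_num) (fun _ _ => rfl) hδ.le hfail
  · rw [DRMDP.hardClass_eq_range hη0 hη1]
    refine (DRMDP.isSignFamily_hardModel hd hη0 hη1
      (fun h => ?_) (fun h => ?_)).hasLowerBound hd hK1 hη
      (DRMDP.quarter_le_prod_firstLevel hρ1) ?_ hδ.le hfail
    · simp only [DRMDP.firstLevel]; split_ifs <;> linarith
    · simp only [DRMDP.firstLevel]; split_ifs <;> linarith
    · rintro s rfl
      rfl
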